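/- Let $d\ge 1$ be an integer and let $\varpi\ge 2$ be real. There is a constant $C$, depending only on $d$ and $\varpi$, such that for every real $\eta$ with $0\le \frac{\eta}{d}\le\frac{\varpi}{2}-1$ the following holds. For every $x\in\mathbb{R}^d$ the oscillatory integral $$ I^{\eta}S^{\varpi}(x)=\int_{\mathbb{R}^{d}}e^{i(|\xi|^{\varpi}+x\cdot\xi)}\,|\xi|^{\eta}\,d\xi $$ exists and $$ \sup_{x\in\mathbb{R}^d}\left|I^{\eta}S^{\varpi}(x)\right|\le C . $$ Moreover, for every $t>0$ and every $x\in\mathbb{R}^d$ the oscillatory integral below exists and $$ \int_{\mathbb{R}^{d}}e^{i(t|\xi|^{\varpi}+x\cdot\xi)}\,|\xi|^{\eta}\,d\xi = t^{-\frac{d+\eta}{\varpi}}\, I^{\eta}S^{\varpi}\!\left(t^{-\frac1\varpi}x\right), \qquad \left|\int_{\mathbb{R}^{d}}e^{i(t|\xi|^{\varpi}+x\cdot\xi)}\,|\xi|^{\eta}\,d\xi\right|\le C\,t^{-\frac{d+\eta}{\varpi}} . $$ Here an oscillatory integral $\int_{\mathbb{R}^d} f(\xi)\,d\xi$ exists with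 value $z\in\mathbb{C}$ if, for every Schwartz function $\chi$ on $\mathbb{R}^d$ with $\chi(0)=1$, the integrals $\int_{\mathbb{R}^d} f(\xi)\chi(\varepsilon\xi)\,d\xi$, $\varepsilon>0$, converge absolutely and tend to $z$ as $\varepsilon\to0^+$. Furthermore, for every $t>0$ the function $K_t(x)=\int_{\mathbb{R}^{d}}e^{i(t|\xi|^{\varpi}+x\cdot\xi)}|\xi|^{\eta}\,d\xi$ obtained in this way is the inverse Fourier transform of the tempered distribution $m_t(\xi)=e^{it|\xi|^{\varpi}}|\xi|^{\eta}$, that is, $\int m_t(\xi)\left(\int e^{ix\cdot\xi}\varphi(x)\,dx\right)d\xi=\int K_t(x)\varphi(x)\,dx$ for every Schwartz function $\varphi$ on $\mathbb{R}^d$, where both outer integrals converge absolutely. -/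

import Mathlib

open MeasureTheory Filter Topology
open scoped SchwartzMap

/-- `z` is the value of the (in general not absolutely convergent) oscillatory integral
`∫_{ℝ^d} f(ξ) dξ`: for every Schwartz cutoff `χ` with `χ(0) = 1`, the regularized integrals
`∫ f(ξ) χ(εξ) dξ`, `ε > 0`, converge absolutely and tend to `z` as `ε → 0⁺`. -/
def HasOscillatoryIntegral {d : ℕ} (f : EuclideanSpace ℝ (Fin d) → ℂ) (z : ℂ) : Prop :=
  ∀ χ : 𝓢(EuclideanSpace ℝ (Fin d), ℂ), χ 0 = 1 →
    (∀ ε : ℝ, 0 < ε → Integrable (fun ξ => f ξ * χ (ε • ξ))) ∧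
    Tendsto (fun ε : ℝ => ∫ ξ, f ξ * χ (ε • ξ)) (𝓝[>] 0) (𝓝 z)

/-- The unnormalized inverse Fourier transform `(𝓕⁻¹φ)(ξ) = ∫_{ℝ^d} e^{i x·ξ} φ(x) dx`. -/
noncomputable def invFourier {d : ℕ} (φ : EuclideanSpace ℝ (Fin d) → ℂ)
    (ξ : EuclideanSpace ℝ (Fin d)) : ℂ :=
  ∫ x, Complex.exp (Complex.I * ((inner ℝ x ξ : ℝ) : ℂ)) * φ x

/-- The tempered distribution `𝓕⁻¹m`, defined by duality `⟨𝓕⁻¹m, φ⟩ = ⟨m, 𝓕⁻¹φ⟩`, is the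
function `K`. -/
def IsInvFourierTransform {d : ℕ} (m K : EuclideanSpace ℝ (Fin d) → ℂ) : Prop :=
  ∀ φ : 𝓢(EuclideanSpace ℝ (Fin d), ℂ),
    Integrable (fun ξ => m ξ * invFourier φ ξ) ∧ Integrable (fun x => K x * φ x) ∧
    ∫ ξ, m ξ * invFourier φ ξ = ∫ x, K x * φ x

/-- `K(x) = ∫_{ℝ^d} e^{i (t|ξ|^ϖ + x·ξ)} |ξ|^η dξ`, pointwise for every `x` as an oscillatory
integral, and also as an inverse Fourier transform of tempered distributions. -/
def IsDispersiveKernel (d : ℕ) (ϖ η t : ℝ) (K : EuclideanSpace ℝ (Fin d) → ℂ) : Prop :=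
  (∀ x, HasOscillatoryIntegral
    (fun ξ : EuclideanSpace ℝ (Fin d) =>
      Complex.exp (Complex.I * ((t * ‖ξ‖ ^ ϖ + inner ℝ x ξ : ℝ) : ℂ)) * ((‖ξ‖ ^ η : ℝ) : ℂ))
    (K x)) ∧
  IsInvFourierTransform
    (fun ξ : EuclideanSpace ℝ (Fin d) =>
      Complex.exp (Complex.I * ((t * ‖ξ‖ ^ ϖ : ℝ) : ℂ)) * ((‖ξ‖ ^ η : ℝ) : ℂ))
    K

/-! Frequencies are decomposed dyadically. After `ξ = Rζ`, the piece `‖ξ‖ ~ R` is `R^(d+η)` times an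
integral over a fixed annulus with phase `λ(‖ζ‖^ϖ + y·ζ)`, where `λ = R^ϖ` and `y = R^(1-ϖ) x`.
Constants are uniform in all parameters because amplitude and phase are jointly smooth and the
parameters range over a compact set.

If `‖y‖` is too small or too large for a stationary point, repeated integration by parts
(`nonstationary_phase`) gives any power of `λ⁻¹`, so these pieces are `O(R⁻¹)` and sum
geometrically. For each `x` at most four scales are left (`card_critical_scales_le`). There
`exists_annulusIntegral_sq_bound` gives `λ^(-d/2)`, hence the bound `R^(d+η-ϖd/2) ≤ 1`, which is
exactly the upper bound on `η`.

The decay `λ^(-d/2)` is obtained without locating the stationary point. The squared modulus is an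
integral over `h` of autocorrelations, in which `y` survives only as a unimodular factor. The phase
`(‖ζ+h‖^ϖ - ‖ζ‖^ϖ)/‖h‖` has gradient bounded below, since the gradient of `‖ζ‖^ϖ` is strongly
monotone (`le_inner_rpow_sub`). Decay `(1+λ‖h‖)^(-d-1)` then integrates to a multiple of `λ^(-d)`.

So the truncated kernels are uniformly bounded and converge locally uniformly to a continuous `K`
(`exists_kernel`), and the multiplication formula passes to the limit. A cutoff `χ` with `χ(0) = 1`
is the inverse transform of an integrable `φ` of mass one, so the regularized integrals are averages
`∫ K(x+εz) φ(z) dz`, which tend to `K(x)`. General `t` follows by dilating the weak identity. -/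

open scoped ContDiff

/-! ### Smooth auxiliary functions -/

/-- Integrals over `[0, 1]` depend smoothly on parameters. -/
theorem contDiff_intervalIntegral_param {P : Type*} [NormedAddCommGroup P] [NormedSpace ℝ P]
    {F : P × ℝ → ℝ} (hF : ContDiff ℝ ∞ F) :
    ContDiff ℝ ∞ (fun p => ∫ s in (0 : ℝ)..1, F (p, s)) := by
  -- The integral is the convolution, at the point 0, of the indicator of `(0, 1]` with `x ↦ F (p,
  -- -x)`. The bump is 1 on `[-1, 1]`, so it supplies compact support without changing the value.
  let b : ContDiffBump (0 : ℝ) := ⟨1, 2, one_pos, one_lt_two⟩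
  let f : ℝ → ℝ := (Set.Ioc (0 : ℝ) 1).indicator 1
  let g : P → ℝ → ℝ := fun p x => b x * F (p, -x)
  have hf : LocallyIntegrable f := by
    refine Integrable.locallyIntegrable ?_
    rw [integrable_indicator_iff measurableSet_Ioc]
    exact integrableOn_const (by simp)
  have hg : ContDiff ℝ ∞ (fun q : P × ℝ => b q.2 * F (q.1, -q.2)) :=
    (b.contDiff.comp contDiff_snd).mul (hF.comp (contDiff_fst.prodMk contDiff_snd.neg))
  have key := contDiffOn_convolution_right_with_param_comp (n := ⊤) (μ := volume)
    (ContinuousLinearMap.mul ℝ ℝ) (s := (Set.univ : Set P)) (v := fun _ => (0 : ℝ))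
    contDiffOn_const (f := f) (g := g) (k := Metric.closedBall 0 2) isOpen_univ
    (isCompact_closedBall _ _) (by
      intro p x _ hx
      have : b x = 0 := b.zero_of_le_dist (by
        rw [Metric.mem_closedBall, not_le] at hx
        exact hx.le)
      simp [g, this]) hf hg.contDiffOn
  rw [contDiffOn_univ] at key
  convert key using 2 with p
  rw [convolution_def, intervalIntegral.integral_of_le zero_le_one,
    ← integral_indicator measurableSet_Ioc]
  congr 1 with s
  by_cases hs : s ∈ Set.Ioc (0 : ℝ) 1
  · have : b (0 - s) = 1 := b.one_of_mem_closedBall (by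
      simp only [zero_sub, Metric.mem_closedBall, dist_zero_right, norm_neg, Real.norm_eq_abs, b]
      rw [abs_of_pos hs.1]; exact hs.2)
    simp only [f, g, Set.indicator_of_mem hs, ContinuousLinearMap.mul_apply', this]
    simp
  · simp [f, Set.indicator_of_notMem hs]

/-- A smooth function on `ℝ` that agrees with the inverse on `[c, ∞)`. -/
noncomputable def smoothInv (c u : ℝ) : ℝ := Real.smoothTransition (2 * u / c - 1) * u⁻¹

theorem smoothInv_of_le {c u : ℝ} (hc : 0 < c) (h : c ≤ u) : smoothInv c u = u⁻¹ := by
  have : 1 ≤ 2 * u / c - 1 := by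
    rw [le_sub_iff_add_le, le_div_iff₀ hc]; linarith
  simp [smoothInv, Real.smoothTransition.one_of_one_le this]

/-- The transition factor vanishes for `u ≤ c / 2`, which hides the singularity of `u⁻¹`. -/
theorem contDiff_smoothInv {c : ℝ} (hc : 0 < c) : ContDiff ℝ ∞ (smoothInv c) := by
  rw [contDiff_iff_contDiffAt]
  intro u
  by_cases hu : u = 0
  · have : smoothInv c =ᶠ[𝓝 u] fun _ => 0 := by
      have h : ∀ᶠ v in 𝓝 u, v < c / 2 := (isOpen_Iio).mem_nhds (by
        simp only [Set.mem_Iio, hu]; positivity)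
      filter_upwards [h] with v hv
      have : 2 * v / c - 1 ≤ 0 := by
        rw [sub_nonpos, div_le_one hc]; linarith
      simp [smoothInv, Real.smoothTransition.zero_of_nonpos this]
    exact contDiffAt_const.congr_of_eventuallyEq this
  · have h1 : ContDiffAt ℝ ∞ (fun v => Real.smoothTransition (2 * v / c - 1)) u := by
      have : ContDiff ℝ ∞ (fun v : ℝ => 2 * v / c - 1) :=
        ((contDiff_const.mul contDiff_id).div_const c).sub contDiff_const
      exact (Real.smoothTransition.contDiff.comp this).contDiffAt
    exact h1.mul (contDiffAt_inv ℝ hu)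

/-! ### Nonstationary phase with parameters -/

section NonstationaryPhase

variable {d : ℕ} {P F : Type*} [NormedAddCommGroup P] [NormedSpace ℝ P]
  [NormedAddCommGroup F] [NormedSpace ℝ F]

/-- The partial derivative in the `i`-th coordinate of the second variable. -/
noncomputable def partialSnd (i : Fin d) (f : P × EuclideanSpace ℝ (Fin d) → F)
    (q : P × EuclideanSpace ℝ (Fin d)) : F :=
  fderiv ℝ f q (0, EuclideanSpace.single i 1)

theorem ContDiff.partialSnd {f : P × EuclideanSpace ℝ (Fin d) → F} (hf : ContDiff ℝ ∞ f)
    (i : Fin d) : ContDiff ℝ ∞ (partialSnd i f) :=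
  (hf.fderiv_right (m := ∞) (by simp)).clm_apply contDiff_const

theorem fderiv_slice_apply {f : P × EuclideanSpace ℝ (Fin d) → F} (hf : ContDiff ℝ ∞ f)
    (p : P) (ξ v : EuclideanSpace ℝ (Fin d)) :
    fderiv ℝ (fun ζ => f (p, ζ)) ξ v = fderiv ℝ f (p, ξ) (0, v) := by
  have h1 : HasFDerivAt f (fderiv ℝ f (p, ξ)) (p, ξ) :=
    (hf.differentiable (by simp) _).hasFDerivAt
  have h2 : HasFDerivAt (fun ζ : EuclideanSpace ℝ (Fin d) => (p, ζ))
      (ContinuousLinearMap.inr ℝ P (EuclideanSpace ℝ (Fin d))) ξ := hasFDerivAt_prodMk_right p ξ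
  have h3 := h1.comp ξ h2
  have h4 : fderiv ℝ (fun ζ => f (p, ζ)) ξ = _ := h3.fderiv
  rw [h4]
  simp

theorem partialSnd_eq_fderiv_slice {f : P × EuclideanSpace ℝ (Fin d) → F} (hf : ContDiff ℝ ∞ f)
    (i : Fin d) (p : P) (ξ : EuclideanSpace ℝ (Fin d)) :
    partialSnd i f (p, ξ) = fderiv ℝ (fun ζ => f (p, ζ)) ξ (EuclideanSpace.single i 1) :=
  (fderiv_slice_apply hf p ξ _).symm

/-- The squared length of the gradient in the second variable. -/
noncomputable def gradSq (Φ : P × EuclideanSpace ℝ (Fin d) → ℝ)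
    (q : P × EuclideanSpace ℝ (Fin d)) : ℝ :=
  ∑ k, partialSnd k Φ q ^ 2

theorem ContDiff.gradSq {Φ : P × EuclideanSpace ℝ (Fin d) → ℝ} (hΦ : ContDiff ℝ ∞ Φ) :
    ContDiff ℝ ∞ (gradSq Φ) :=
  ContDiff.sum fun k _ => (hΦ.partialSnd k).pow 2

/-- The gradient dominates every directional derivative. -/
theorem sq_fderiv_slice_le_gradSq {Φ : P × EuclideanSpace ℝ (Fin d) → ℝ} (hΦ : ContDiff ℝ ∞ Φ)
    (p : P) (ξ v : EuclideanSpace ℝ (Fin d)) :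
    (fderiv ℝ (fun ζ => Φ (p, ζ)) ξ v) ^ 2 ≤ gradSq Φ (p, ξ) * ‖v‖ ^ 2 := by
  have hv : v = ∑ k, v k • EuclideanSpace.single k (1 : ℝ) := by
    ext j
    simp [Finset.sum_apply, Pi.single_apply]
  have h1 : fderiv ℝ (fun ζ => Φ (p, ζ)) ξ v = ∑ k, partialSnd k Φ (p, ξ) * v k := by
    conv_lhs => rw [hv]
    rw [map_sum]
    refine Finset.sum_congr rfl fun k _ => ?_
    rw [map_smul, smul_eq_mul, partialSnd_eq_fderiv_slice hΦ, mul_comm]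
  rw [h1, EuclideanSpace.real_norm_sq_eq]
  exact Finset.sum_mul_sq_le_sq_mul_sq _ _ _

/-- The vector field `∇Φ / |∇Φ|²`, smoothly modified where `|∇Φ|² < c`. -/
noncomputable def phaseField (c : ℝ) (Φ : P × EuclideanSpace ℝ (Fin d) → ℝ) (i : Fin d)
    (q : P × EuclideanSpace ℝ (Fin d)) : ℝ :=
  smoothInv c (gradSq Φ q) * partialSnd i Φ q

/-- The amplitude produced by one integration by parts against `e^{iλΦ}`. -/
noncomputable def phaseAdjoint (c : ℝ) (Φ : P × EuclideanSpace ℝ (Fin d) → ℝ)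
    (f : P × EuclideanSpace ℝ (Fin d) → ℂ) (q : P × EuclideanSpace ℝ (Fin d)) : ℂ :=
  ∑ i, partialSnd i (fun q => (phaseField c Φ i q : ℂ) * f q) q

theorem ContDiff.phaseField_mul {c : ℝ} (hc : 0 < c) {Φ : P × EuclideanSpace ℝ (Fin d) → ℝ}
    (hΦ : ContDiff ℝ ∞ Φ) {f : P × EuclideanSpace ℝ (Fin d) → ℂ} (hf : ContDiff ℝ ∞ f)
    (i : Fin d) : ContDiff ℝ ∞ (fun q => (phaseField c Φ i q : ℂ) * f q) :=
  (Complex.ofRealCLM.contDiff.comp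
    (((contDiff_smoothInv hc).comp hΦ.gradSq).mul (hΦ.partialSnd i))).mul hf

theorem ContDiff.phaseAdjoint {c : ℝ} (hc : 0 < c) {Φ : P × EuclideanSpace ℝ (Fin d) → ℝ}
    (hΦ : ContDiff ℝ ∞ Φ) {f : P × EuclideanSpace ℝ (Fin d) → ℂ} (hf : ContDiff ℝ ∞ f) :
    ContDiff ℝ ∞ (phaseAdjoint c Φ f) :=
  ContDiff.sum fun i _ => (ContDiff.phaseField_mul hc hΦ hf i).partialSnd i

/-- The part of the closed ball on which the gradient of the phase is bounded below. -/
def nonstationarySet (c R : ℝ) (Φ : P × EuclideanSpace ℝ (Fin d) → ℝ) (p : P) :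
    Set (EuclideanSpace ℝ (Fin d)) :=
  {ξ | ‖ξ‖ ≤ R ∧ c ≤ gradSq Φ (p, ξ)}

theorem isClosed_nonstationarySet (c R : ℝ) {Φ : P × EuclideanSpace ℝ (Fin d) → ℝ}
    (hΦ : ContDiff ℝ ∞ Φ) (p : P) : IsClosed (nonstationarySet c R Φ p) :=
  (isClosed_le continuous_norm continuous_const).inter
    (isClosed_le continuous_const (hΦ.gradSq.continuous.comp (by fun_prop)))

theorem partialSnd_eq_zero_of_notMem {f : P × EuclideanSpace ℝ (Fin d) → F}
    (hf : ContDiff ℝ ∞ f) {S : Set (EuclideanSpace ℝ (Fin d))} (hS : IsClosed S) {p : P}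
    (h0 : ∀ ξ ∉ S, f (p, ξ) = 0) (i : Fin d) {ξ : EuclideanSpace ℝ (Fin d)} (hξ : ξ ∉ S) :
    partialSnd i f (p, ξ) = 0 := by
  rw [partialSnd_eq_fderiv_slice hf]
  have : (fun ζ => f (p, ζ)) =ᶠ[𝓝 ξ] fun _ => 0 := by
    filter_upwards [hS.isOpen_compl.mem_nhds hξ] with ζ hζ using h0 ζ hζ
  rw [this.fderiv_eq]
  simp

/-- Differentiation does not enlarge a closed support. This lets the integration by parts be
iterated under the same support hypothesis. -/
theorem phaseAdjoint_eq_zero_of_notMem {c : ℝ} (hc : 0 < c)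
    {Φ : P × EuclideanSpace ℝ (Fin d) → ℝ} (hΦ : ContDiff ℝ ∞ Φ)
    {f : P × EuclideanSpace ℝ (Fin d) → ℂ} (hf : ContDiff ℝ ∞ f)
    {S : Set (EuclideanSpace ℝ (Fin d))} (hS : IsClosed S) {p : P}
    (h0 : ∀ ξ ∉ S, f (p, ξ) = 0) {ξ : EuclideanSpace ℝ (Fin d)} (hξ : ξ ∉ S) :
    phaseAdjoint c Φ f (p, ξ) = 0 :=
  Finset.sum_eq_zero fun i _ =>
    partialSnd_eq_zero_of_notMem (ContDiff.phaseField_mul hc hΦ hf i) hS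
      (fun ζ hζ => by simp [h0 ζ hζ]) i hξ

/-- The oscillating factor `e^{iλΦ}`. -/
noncomputable def oscFactor (lam : ℝ) (u : ℝ) : ℂ := Complex.exp (Complex.I * ((lam * u : ℝ) : ℂ))

theorem norm_oscFactor (lam u : ℝ) : ‖oscFactor lam u‖ = 1 := by
  rw [oscFactor, mul_comm, Complex.norm_exp_ofReal_mul_I]

theorem contDiff_oscFactor (lam : ℝ) : ContDiff ℝ ∞ (oscFactor lam) := by
  have : ContDiff ℝ ∞ fun u : ℝ => Complex.I * ((lam * u : ℝ) : ℂ) :=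
    contDiff_const.mul (Complex.ofRealCLM.contDiff.comp (contDiff_const.mul contDiff_id))
  exact (Complex.contDiff_exp (𝕜 := ℝ)).comp this

theorem hasDerivAt_oscFactor (lam u : ℝ) :
    HasDerivAt (oscFactor lam) (oscFactor lam u * (Complex.I * lam)) u := by
  have h : HasDerivAt (fun u : ℝ => Complex.I * ((lam * u : ℝ) : ℂ)) (Complex.I * lam) u := by
    have h1 : HasDerivAt (fun u : ℝ => ((lam * u : ℝ) : ℂ)) (lam : ℂ) u := by
      have := ((hasDerivAt_id u).const_mul lam).ofReal_comp
      simpa using this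
    exact h1.const_mul _
  exact h.cexp

theorem integrable_slice {f : EuclideanSpace ℝ (Fin d) → ℂ} (hf : Continuous f) {R : ℝ}
    (h0 : ∀ ξ, R < ‖ξ‖ → f ξ = 0) : Integrable f :=
  hf.integrable_of_hasCompactSupport
    (HasCompactSupport.intro (isCompact_closedBall 0 R) fun ξ hξ => h0 ξ (by
      simpa using hξ))

/-- With `V = ∇Φ / |∇Φ|²` one has `V · ∇e^{iλΦ} = iλ e^{iλΦ}`. Moving `V` onto the amplitude by
parts costs `-1/(iλ) = i/λ`. -/
theorem integral_oscFactor_mul_eq {c : ℝ} (hc : 0 < c) {R : ℝ}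
    {Φ : P × EuclideanSpace ℝ (Fin d) → ℝ} (hΦ : ContDiff ℝ ∞ Φ)
    {f : P × EuclideanSpace ℝ (Fin d) → ℂ} (hf : ContDiff ℝ ∞ f) {p : P}
    (h0 : ∀ ξ ∉ nonstationarySet c R Φ p, f (p, ξ) = 0) {lam : ℝ} (hlam : 0 < lam) :
    ∫ ξ, oscFactor lam (Φ (p, ξ)) * f (p, ξ) =
      Complex.I / lam * ∫ ξ, oscFactor lam (Φ (p, ξ)) * phaseAdjoint c Φ f (p, ξ) := by
  have hS := isClosed_nonstationarySet c R hΦ p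
  have hslice : ContDiff ℝ ∞ fun ζ : EuclideanSpace ℝ (Fin d) => (p, ζ) :=
    contDiff_prodMk_right p
  have hu : ContDiff ℝ ∞ fun ξ => oscFactor lam (Φ (p, ξ)) :=
    (contDiff_oscFactor lam).comp (hΦ.comp hslice)
  have hR : ∀ ξ, R < ‖ξ‖ → ξ ∉ nonstationarySet c R Φ p := fun ξ h h' => absurd h'.1 (not_le.2 h)
  have hv := fun i => ContDiff.phaseField_mul hc hΦ hf i
  have hv0 : ∀ i, ∀ ξ ∉ nonstationarySet c R Φ p,
      (phaseField c Φ i (p, ξ) : ℂ) * f (p, ξ) = 0 := fun i ξ hξ => by simp [h0 ξ hξ]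
  have hdu : ∀ i ξ, fderiv ℝ (fun ξ => oscFactor lam (Φ (p, ξ))) ξ (EuclideanSpace.single i 1) =
      oscFactor lam (Φ (p, ξ)) * (Complex.I * lam) * partialSnd i Φ (p, ξ) := by
    intro i ξ
    have h1 : HasFDerivAt (fun ξ => Φ (p, ξ)) (fderiv ℝ (fun ξ => Φ (p, ξ)) ξ) ξ :=
      ((hΦ.comp hslice).differentiable (by simp) ξ).hasFDerivAt
    have h2 := (HasFDerivAt.comp (g := oscFactor lam) ξ
      (hasDerivAt_oscFactor lam (Φ (p, ξ))).hasFDerivAt h1).fderiv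
    rw [Function.comp_def] at h2
    rw [h2, partialSnd_eq_fderiv_slice hΦ]
    simp [mul_comm]
  have hparts : ∀ i, ∫ ξ, oscFactor lam (Φ (p, ξ)) *
      partialSnd i (fun q => (phaseField c Φ i q : ℂ) * f q) (p, ξ) =
      - ∫ ξ, oscFactor lam (Φ (p, ξ)) * (Complex.I * lam) * partialSnd i Φ (p, ξ) *
        ((phaseField c Φ i (p, ξ) : ℂ) * f (p, ξ)) := by
    intro i
    have := integral_mul_fderiv_eq_neg_fderiv_mul_of_integrable
      (μ := (volume : Measure (EuclideanSpace ℝ (Fin d))))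
      (f := fun ξ => oscFactor lam (Φ (p, ξ)))
      (g := fun ξ => (phaseField c Φ i (p, ξ) : ℂ) * f (p, ξ))
      (v := EuclideanSpace.single i 1) ?_ ?_ ?_
      (fun ξ _ => hu.differentiable (by simp) ξ)
      (fun ξ _ => ((hv i).comp hslice).differentiable (by simp) ξ)
    · simp_rw [hdu] at this
      rw [← this]
      congr 1 with ξ
      rw [partialSnd_eq_fderiv_slice (hv i)]
    · refine integrable_slice (R := R) ?_ fun ξ hξ => by rw [hv0 i ξ (hR ξ hξ), mul_zero]
      exact ((hu.continuous_fderiv (by simp)).clm_apply continuous_const).mul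
        ((hv i).comp hslice).continuous
    · refine integrable_slice (R := R) ?_ fun ξ hξ => ?_
      · exact hu.continuous.mul
          ((((hv i).comp hslice).continuous_fderiv (by simp)).clm_apply continuous_const)
      · rw [← partialSnd_eq_fderiv_slice (hv i),
          partialSnd_eq_zero_of_notMem (hv i) hS (hv0 i) i (hR ξ hξ), mul_zero]
    · exact integrable_slice (R := R) (hu.continuous.mul ((hv i).comp hslice).continuous)
        fun ξ hξ => by rw [hv0 i ξ (hR ξ hξ), mul_zero]
  -- Only here must `smoothInv` be a true inverse. Where `|∇Φ|² < c` the field is arbitrary, but `f`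
  -- vanishes.
  have hsum : ∀ ξ, ∑ i, oscFactor lam (Φ (p, ξ)) * (Complex.I * lam) * partialSnd i Φ (p, ξ) *
      ((phaseField c Φ i (p, ξ) : ℂ) * f (p, ξ)) =
      Complex.I * lam * (oscFactor lam (Φ (p, ξ)) * f (p, ξ)) := by
    intro ξ
    by_cases hξ : ξ ∈ nonstationarySet c R Φ p
    · have hg : ∑ i, partialSnd i Φ (p, ξ) * phaseField c Φ i (p, ξ) = 1 := by
        have hpos : gradSq Φ (p, ξ) ≠ 0 := (hc.trans_le hξ.2).ne'
        simp only [phaseField, smoothInv_of_le hc hξ.2]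
        rw [← mul_inv_cancel₀ hpos]
        conv_rhs => rw [gradSq, Finset.sum_mul]
        exact Finset.sum_congr rfl fun i _ => by rw [gradSq]; ring
      have hg' : ∑ i, ((partialSnd i Φ (p, ξ) : ℝ) : ℂ) * (phaseField c Φ i (p, ξ) : ℂ) = 1 := by
        exact_mod_cast hg
      calc _ = Complex.I * lam * (oscFactor lam (Φ (p, ξ)) * f (p, ξ)) *
            ∑ i, ((partialSnd i Φ (p, ξ) : ℝ) : ℂ) * (phaseField c Φ i (p, ξ) : ℂ) := by
            rw [Finset.mul_sum]
            exact Finset.sum_congr rfl fun i _ => by ring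
        _ = _ := by rw [hg', mul_one]
    · simp [h0 ξ hξ]
  have hInt1 : ∀ i, Integrable fun ξ => oscFactor lam (Φ (p, ξ)) *
      partialSnd i (fun q => (phaseField c Φ i q : ℂ) * f q) (p, ξ) := fun i =>
    integrable_slice (R := R)
      (hu.continuous.mul (((hv i).partialSnd i).comp hslice).continuous) fun ξ hξ => by
      rw [partialSnd_eq_zero_of_notMem (hv i) hS (hv0 i) i (hR ξ hξ), mul_zero]
  have hInt2 : ∀ i, Integrable fun ξ => oscFactor lam (Φ (p, ξ)) * (Complex.I * lam) *
      partialSnd i Φ (p, ξ) * ((phaseField c Φ i (p, ξ) : ℂ) * f (p, ξ)) := fun i => by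
    refine integrable_slice (R := R) ?_ fun ξ hξ => by rw [hv0 i ξ (hR ξ hξ), mul_zero]
    exact ((hu.continuous.mul continuous_const).mul
      (Complex.continuous_ofReal.comp ((hΦ.partialSnd i).comp hslice).continuous)).mul
      ((hv i).comp hslice).continuous
  have hmain : ∫ ξ, oscFactor lam (Φ (p, ξ)) * phaseAdjoint c Φ f (p, ξ) =
      -(Complex.I * lam * ∫ ξ, oscFactor lam (Φ (p, ξ)) * f (p, ξ)) := by
    simp only [phaseAdjoint, Finset.mul_sum]
    rw [integral_finsetSum _ fun i _ => hInt1 i]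
    simp_rw [hparts]
    rw [Finset.sum_neg_distrib, ← integral_finsetSum _ fun i _ => hInt2 i]
    simp_rw [hsum]
    rw [integral_const_mul]
  rw [hmain]
  have : (lam : ℂ) ≠ 0 := by exact_mod_cast hlam.ne'
  field_simp
  rw [Complex.I_sq]; ring

/-- **Nonstationary phase**, uniformly over a compact set of parameters. -/
theorem nonstationary_phase {c : ℝ} (hc : 0 < c) (R : ℝ)
    {Φ : P × EuclideanSpace ℝ (Fin d) → ℝ} (hΦ : ContDiff ℝ ∞ Φ)
    {f : P × EuclideanSpace ℝ (Fin d) → ℂ} (hf : ContDiff ℝ ∞ f) {K : Set P} (hK : IsCompact K)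
    (N : ℕ) :
    ∃ C : ℝ, 0 ≤ C ∧ ∀ p ∈ K, (∀ ξ ∉ nonstationarySet c R Φ p, f (p, ξ) = 0) →
      ∀ lam : ℝ, 0 < lam → ‖∫ ξ, oscFactor lam (Φ (p, ξ)) * f (p, ξ)‖ ≤ C * lam⁻¹ ^ N := by
  induction N generalizing f with
  | zero =>
    obtain ⟨M, hM⟩ := (hK.prod (isCompact_closedBall (0 : EuclideanSpace ℝ (Fin d))
      R)).exists_bound_of_continuousOn hf.continuous.continuousOn
    let V := (volume : Measure (EuclideanSpace ℝ (Fin d))).real (Metric.closedBall 0 R)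
    -- The bound `M` may be negative when the compact set is empty, hence the absolute value.
    refine ⟨|M| * V, by positivity, fun p hp h0 lam _ => ?_⟩
    have hR : ∀ ξ ∉ Metric.closedBall (0 : EuclideanSpace ℝ (Fin d)) R,
        oscFactor lam (Φ (p, ξ)) * f (p, ξ) = 0 := fun ξ hξ => by
      rw [h0 ξ fun h => hξ (by simpa using h.1), mul_zero]
    rw [← setIntegral_eq_integral_of_forall_compl_eq_zero hR, pow_zero, mul_one]
    refine norm_setIntegral_le_of_norm_le_const measure_closedBall_lt_top fun ξ hξ => ?_
    rw [norm_mul, norm_oscFactor, one_mul]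
    exact (hM (p, ξ) ⟨hp, hξ⟩).trans (le_abs_self M)
  | succ N ih =>
    -- The constant belongs to the new amplitude and is fixed before `p` and `lam`, which keeps it
    -- uniform.
    obtain ⟨C, hC, h⟩ := ih (ContDiff.phaseAdjoint hc hΦ hf)
    refine ⟨C, hC, fun p hp h0 lam hlam => ?_⟩
    rw [integral_oscFactor_mul_eq hc hΦ hf h0 hlam, norm_mul]
    have h1 := h p hp (fun ξ hξ => phaseAdjoint_eq_zero_of_notMem hc hΦ hf
      (isClosed_nonstationarySet c R hΦ p) h0 hξ) lam hlam
    have h2 : ‖Complex.I / (lam : ℂ)‖ = lam⁻¹ := by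
      rw [norm_div, Complex.norm_I, Complex.norm_real, Real.norm_of_nonneg hlam.le, one_div]
    rw [h2, pow_succ]
    calc lam⁻¹ * _ ≤ lam⁻¹ * (C * lam⁻¹ ^ N) := by gcongr
      _ = _ := by ring

end NonstationaryPhase

/-! ### Localization to an annulus, and the difference quotient of the phase -/

section Annulus

variable {d : ℕ}

/-- A smooth function that agrees with `log ‖ξ‖` for `1/4 ≤ ‖ξ‖`. -/
noncomputable def smoothLog (ξ : EuclideanSpace ℝ (Fin d)) : ℝ :=
  Real.smoothTransition (32 * ‖ξ‖ ^ 2 - 1) * Real.log ‖ξ‖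

theorem contDiff_smoothLog : ContDiff ℝ ∞ (smoothLog (d := d)) := by
  rw [contDiff_iff_contDiffAt]
  intro ξ
  have h2 : ContDiff ℝ ∞ fun ζ : EuclideanSpace ℝ (Fin d) => 32 * ‖ζ‖ ^ 2 - 1 :=
    (contDiff_const.mul (contDiff_norm_sq ℝ)).sub contDiff_const
  by_cases hξ : ξ = 0
  · have h : smoothLog (d := d) =ᶠ[𝓝 ξ] fun _ => 0 := by
      have : ∀ᶠ ζ in 𝓝 ξ, 32 * ‖ζ‖ ^ 2 - 1 < 0 :=
        h2.continuous.continuousAt.eventually_lt_const (by simp [hξ])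
      filter_upwards [this] with ζ hζ
      simp [smoothLog, Real.smoothTransition.zero_of_nonpos hζ.le]
    exact contDiffAt_const.congr_of_eventuallyEq h
  · have h1 : ContDiffAt ℝ ∞ (fun ζ : EuclideanSpace ℝ (Fin d) =>
        Real.smoothTransition (32 * ‖ζ‖ ^ 2 - 1)) ξ :=
      (Real.smoothTransition.contDiff.comp h2).contDiffAt
    exact h1.mul ((contDiffAt_norm ℝ hξ).log (norm_ne_zero_iff.2 hξ))

theorem smoothLog_of_le {ξ : EuclideanSpace ℝ (Fin d)} (h : 1 / 4 ≤ ‖ξ‖) :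
    smoothLog ξ = Real.log ‖ξ‖ := by
  -- At `‖ξ‖ = 1/4` the argument `32 ‖ξ‖ ^ 2 - 1` equals 1.
  rw [smoothLog, Real.smoothTransition.one_of_one_le (by nlinarith), one_mul]

/-- A smooth function that agrees with `‖ξ‖ ^ w` for `1/4 ≤ ‖ξ‖`. -/
noncomputable def smoothPow (w : ℝ) (ξ : EuclideanSpace ℝ (Fin d)) : ℝ :=
  Real.exp (w * smoothLog ξ)

theorem contDiff_smoothPow (w : ℝ) : ContDiff ℝ ∞ (smoothPow (d := d) w) :=
  (contDiff_const.mul contDiff_smoothLog).exp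

theorem smoothPow_of_le (w : ℝ) {ξ : EuclideanSpace ℝ (Fin d)} (h : 1 / 4 ≤ ‖ξ‖) :
    smoothPow w ξ = ‖ξ‖ ^ w := by
  rw [smoothPow, smoothLog_of_le h, Real.rpow_def_of_pos (by linarith), mul_comm]

/-- The strict inequality gives a whole neighbourhood on which the power is genuine. The annulus
begins at `1/2`, well inside. -/
theorem fderiv_smoothPow {w : ℝ} (hw : 1 < w) {ξ : EuclideanSpace ℝ (Fin d)} (h : 1 / 4 < ‖ξ‖)
    (v : EuclideanSpace ℝ (Fin d)) :
    fderiv ℝ (smoothPow w) ξ v = w * ‖ξ‖ ^ (w - 2) * inner ℝ ξ v := by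
  have h1 : smoothPow w =ᶠ[𝓝 ξ] fun ζ => ‖ζ‖ ^ w := by
    filter_upwards [continuous_norm.continuousAt.eventually_const_lt h] with ζ hζ
      using smoothPow_of_le w (le_of_lt hζ)
  rw [h1.fderiv_eq, (hasFDerivAt_norm_rpow ξ hw).fderiv]
  simp

/-- A smooth radial cutoff: `1` on the unit ball, `0` off the ball of radius `2`. -/
noncomputable def ballCutoff (d : ℕ) : ContDiffBump (0 : EuclideanSpace ℝ (Fin d)) :=
  ⟨1, 2, one_pos, one_lt_two⟩

theorem ballCutoff_of_le {ξ : EuclideanSpace ℝ (Fin d)} (h : ‖ξ‖ ≤ 1) : ballCutoff d ξ = 1 :=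
  (ballCutoff d).one_of_mem_closedBall (by simpa [ballCutoff] using h)

theorem ballCutoff_of_ge {ξ : EuclideanSpace ℝ (Fin d)} (h : 2 ≤ ‖ξ‖) : ballCutoff d ξ = 0 :=
  (ballCutoff d).zero_of_le_dist (by simpa [ballCutoff] using h)

/-- The dyadic cutoff to the annulus `1/2 < ‖ξ‖ < 2`. -/
noncomputable def annulusCutoff (ξ : EuclideanSpace ℝ (Fin d)) : ℝ :=
  ballCutoff d ξ - ballCutoff d ((2 : ℝ) • ξ)

theorem contDiff_annulusCutoff : ContDiff ℝ ∞ (annulusCutoff (d := d)) :=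
  (ballCutoff d).contDiff.sub ((ballCutoff d).contDiff.comp (contDiff_const_smul _))

theorem annulusCutoff_of_le {ξ : EuclideanSpace ℝ (Fin d)} (h : ‖ξ‖ ≤ 1 / 2) :
    annulusCutoff ξ = 0 := by
  rw [annulusCutoff, ballCutoff_of_le (by linarith), ballCutoff_of_le, sub_self]
  rw [norm_smul, Real.norm_ofNat]; linarith

theorem annulusCutoff_of_ge {ξ : EuclideanSpace ℝ (Fin d)} (h : 2 ≤ ‖ξ‖) :
    annulusCutoff ξ = 0 := by
  rw [annulusCutoff, ballCutoff_of_ge h, ballCutoff_of_ge, sub_self]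
  rw [norm_smul, Real.norm_ofNat]; linarith

/-- The amplitude `‖ξ‖ ^ η` localized to the annulus. -/
noncomputable def annulusAmp (η : ℝ) (ξ : EuclideanSpace ℝ (Fin d)) : ℂ :=
  ((annulusCutoff ξ * smoothPow η ξ : ℝ) : ℂ)

/-- Smoothness in the exponent as well as the point makes `η` one of the compact parameters, so that
later constants do not depend on it. -/
theorem ContDiff.annulusAmp {X : Type*} [NormedAddCommGroup X] [NormedSpace ℝ X] {a : X → ℝ}
    {b : X → EuclideanSpace ℝ (Fin d)} (ha : ContDiff ℝ ∞ a) (hb : ContDiff ℝ ∞ b) :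
    ContDiff ℝ ∞ (fun x => annulusAmp (a x) (b x)) :=
  Complex.ofRealCLM.contDiff.comp ((contDiff_annulusCutoff.comp hb).mul
    (ha.mul (contDiff_smoothLog.comp hb)).exp)

theorem norm_mem_of_annulusAmp_ne_zero {η : ℝ} {ξ : EuclideanSpace ℝ (Fin d)}
    (h : annulusAmp η ξ ≠ 0) : 1 / 2 < ‖ξ‖ ∧ ‖ξ‖ < 2 := by
  constructor
  · by_contra! h'
    exact h (by simp [annulusAmp, annulusCutoff_of_le h'])
  · by_contra! h'
    exact h (by simp [annulusAmp, annulusCutoff_of_ge h'])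

/-- The gradient of `‖ξ‖ ^ w` is strongly monotone away from the origin. -/
theorem le_inner_rpow_sub {V : Type*} [NormedAddCommGroup V] [InnerProductSpace ℝ V] {w m : ℝ}
    (hw : 2 ≤ w) (hm : 0 ≤ m) {a b : V} (ha : m ≤ ‖a‖) (hb : m ≤ ‖b‖) :
    m ^ (w - 2) * ‖b - a‖ ^ 2 ≤
      ‖b‖ ^ (w - 2) * inner ℝ b (b - a) - ‖a‖ ^ (w - 2) * inner ℝ a (b - a) := by
  have hα : m ^ (w - 2) ≤ ‖a‖ ^ (w - 2) := Real.rpow_le_rpow hm ha (by linarith)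
  have hβ : m ^ (w - 2) ≤ ‖b‖ ^ (w - 2) := Real.rpow_le_rpow hm hb (by linarith)
  -- With `α = ‖a‖^(w-2)` and `β = ‖b‖^(w-2)`, the right-hand side of the goal is `½(α+β)‖b-a‖² +
  -- ½(β-α)(‖b‖²-‖a‖²)`. The last term is nonnegative by monotonicity of the power.
  have hmono : 0 ≤ (‖b‖ ^ (w - 2) - ‖a‖ ^ (w - 2)) * (‖b‖ ^ 2 - ‖a‖ ^ 2) := by
    rcases le_total ‖a‖ ‖b‖ with h | h
    · exact mul_nonneg (sub_nonneg.2 (Real.rpow_le_rpow (norm_nonneg _) h (by linarith)))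
        (sub_nonneg.2 (by gcongr))
    · exact mul_nonneg_of_nonpos_of_nonpos
        (sub_nonpos.2 (Real.rpow_le_rpow (norm_nonneg _) h (by linarith)))
        (sub_nonpos.2 (by gcongr))
  have e1 : inner ℝ b (b - a) = ‖b‖ ^ 2 - inner ℝ b a := by
    rw [inner_sub_right, real_inner_self_eq_norm_sq]
  have e2 : inner ℝ a (b - a) = inner ℝ b a - ‖a‖ ^ 2 := by
    rw [inner_sub_right, real_inner_self_eq_norm_sq, real_inner_comm]
  have e3 : ‖b - a‖ ^ 2 = ‖b‖ ^ 2 - 2 * inner ℝ b a + ‖a‖ ^ 2 := norm_sub_sq_real b a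
  have hsq : 0 ≤ ‖b - a‖ ^ 2 := sq_nonneg _
  rw [e1, e2]
  rw [e3] at hsq ⊢
  nlinarith [mul_le_mul_of_nonneg_right hα hsq, mul_le_mul_of_nonneg_right hβ hsq]

/-- The difference quotient `(‖ξ + r e‖ ^ w - ‖ξ‖ ^ w) / r`, as a function of `((η, r, e), ξ)`,
smooth up to `r = 0`. -/
noncomputable def phaseQuotient (w : ℝ)
    (q : (ℝ × ℝ × EuclideanSpace ℝ (Fin d)) × EuclideanSpace ℝ (Fin d)) : ℝ :=
  ∫ s in (0 : ℝ)..1, fderiv ℝ (smoothPow w) (q.2 + (s * q.1.2.1) • q.1.2.2) q.1.2.2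

theorem contDiff_phaseQuotient (w : ℝ) : ContDiff ℝ ∞ (phaseQuotient (d := d) w) := by
  have h : ContDiff ℝ ∞ (fun z : ((ℝ × ℝ × EuclideanSpace ℝ (Fin d)) ×
      EuclideanSpace ℝ (Fin d)) × ℝ =>
      fderiv ℝ (smoothPow w) (z.1.2 + (z.2 * z.1.1.2.1) • z.1.1.2.2) z.1.1.2.2) := by
    have h1 : ContDiff ℝ ∞ (fderiv ℝ (smoothPow (d := d) w)) :=
      (contDiff_smoothPow w).fderiv_right (by simp)
    exact (h1.comp (by fun_prop)).clm_apply (by fun_prop)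
  exact contDiff_intervalIntegral_param h

/-- This is the fundamental theorem of calculus along the segment from `ξ` to `ξ + r • e`. Taking
`r` out of the phase turns `lam * r` into the large parameter and keeps smoothness down to `r = 0`,
so the parameter set can be compact. -/
theorem mul_phaseQuotient (w η r : ℝ) (e ξ : EuclideanSpace ℝ (Fin d)) :
    r * phaseQuotient w ((η, r, e), ξ) = smoothPow w (ξ + r • e) - smoothPow w ξ := by
  have hd : ∀ s ∈ Set.uIcc (0 : ℝ) 1, HasDerivAt (fun s : ℝ => smoothPow w (ξ + (s * r) • e))
      (r * fderiv ℝ (smoothPow w) (ξ + (s * r) • e) e) s := by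
    intro s _
    have h1 : HasDerivAt (fun s : ℝ => ξ + (s * r) • e) (r • e) s := by
      have := (((hasDerivAt_id s).mul_const r).smul_const e).const_add ξ
      simpa using this
    have h2 := ((contDiff_smoothPow (d := d) w).differentiable (by simp)
      (ξ + (s * r) • e)).hasFDerivAt
    have h3 := h2.comp_hasDerivAt s h1
    rw [map_smul, smul_eq_mul] at h3
    exact h3
  have hc : Continuous fun s : ℝ => r * fderiv ℝ (smoothPow w) (ξ + (s * r) • e) e :=
    continuous_const.mul
      ((((contDiff_smoothPow (d := d) w).continuous_fderiv (by simp)).comp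
        (by fun_prop)).clm_apply continuous_const)
  have := intervalIntegral.integral_eq_sub_of_hasDerivAt hd (hc.intervalIntegrable _ _)
  rw [intervalIntegral.integral_const_mul] at this
  simpa [phaseQuotient] using this

theorem fderiv_phaseQuotient_slice {w η r : ℝ} (e ξ : EuclideanSpace ℝ (Fin d))
    (v : EuclideanSpace ℝ (Fin d)) :
    r * fderiv ℝ (fun ζ => phaseQuotient w ((η, r, e), ζ)) ξ v =
      fderiv ℝ (smoothPow w) (ξ + r • e) v - fderiv ℝ (smoothPow w) ξ v := by
  have hG : DifferentiableAt ℝ (fun ζ => phaseQuotient w ((η, r, e), ζ)) ξ :=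
    ((contDiff_phaseQuotient w).comp (contDiff_prodMk_right _)).differentiable (by simp) ξ
  have hφ := (contDiff_smoothPow (d := d) w).differentiable (by simp)
  have h1 : fderiv ℝ (fun ζ => r * phaseQuotient w ((η, r, e), ζ)) ξ =
      r • fderiv ℝ (fun ζ => phaseQuotient w ((η, r, e), ζ)) ξ := fderiv_const_mul hG r
  have h2 : fderiv ℝ (fun ζ => smoothPow w (ζ + r • e) - smoothPow w ζ) ξ =
      fderiv ℝ (smoothPow w) (ξ + r • e) - fderiv ℝ (smoothPow w) ξ := by
    have h3 : DifferentiableAt ℝ (fun ζ => smoothPow w (ζ + r • e)) ξ :=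
      (differentiableAt_comp_add_right _).2 (hφ (ξ + r • e))
    rw [fderiv_fun_sub h3 (hφ ξ), fderiv_comp_add_right]
  simp_rw [mul_phaseQuotient] at h1
  rw [h2] at h1
  have := congrArg (fun T => T v) h1
  simpa using this.symm

/-- Differentiating in the direction `e` itself brings in strong monotonicity of the gradient of
`‖ξ‖ ^ w`. Its lower bound has the factor `‖r • e‖² = r²`, so the estimate does not degenerate as `r
→ 0`. -/
theorem gradSq_phaseQuotient_ge {w η r : ℝ} (hw : 2 ≤ w) (hr : 0 < r)
    {e ξ : EuclideanSpace ℝ (Fin d)} (he : ‖e‖ = 1) (h1 : 1 / 2 < ‖ξ‖) (h2 : 1 / 2 < ‖ξ + r • e‖) :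
    (w * (1 / 2) ^ (w - 2)) ^ 2 ≤ gradSq (phaseQuotient w) ((η, r, e), ξ) := by
  have key := le_inner_rpow_sub hw (by norm_num) h1.le h2.le
  have hG := fderiv_phaseQuotient_slice (w := w) (η := η) (r := r) e ξ e
  rw [fderiv_smoothPow (by linarith) (by linarith), fderiv_smoothPow (by linarith) (by linarith)]
    at hG
  simp only [add_sub_cancel_left, inner_smul_right, norm_smul, he, mul_one] at key
  rw [Real.norm_of_nonneg hr.le] at key
  set g := fderiv ℝ (fun ζ => phaseQuotient w ((η, r, e), ζ)) ξ e with hg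
  have hge : w * (1 / 2) ^ (w - 2) ≤ g := by
    have : r ^ 2 * (w * (1 / 2) ^ (w - 2)) ≤ r ^ 2 * g := by
      have e1 : r ^ 2 * g = r * (r * g) := by ring
      rw [e1, hG]
      nlinarith [mul_le_mul_of_nonneg_left key (by linarith : (0 : ℝ) ≤ w)]
    exact le_of_mul_le_mul_left this (by positivity)
  have hsq := sq_fderiv_slice_le_gradSq (contDiff_phaseQuotient (d := d) w) (η, r, e) ξ e
  rw [he, one_pow, mul_one] at hsq
  refine le_trans ?_ hsq
  have : 0 ≤ w * (1 / 2 : ℝ) ^ (w - 2) := by positivity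
  gcongr

end Annulus

/-! ### Uniform decay through autocorrelation -/

section StationaryPhase

variable {d : ℕ}

theorem oscFactor_add (lam u v : ℝ) :
    oscFactor lam (u + v) = oscFactor lam u * oscFactor lam v := by
  rw [oscFactor, oscFactor, oscFactor, ← Complex.exp_add]
  congr 1
  push_cast
  ring

theorem oscFactor_mul (lam r u : ℝ) : oscFactor lam (r * u) = oscFactor (lam * r) u := by
  simp only [oscFactor, mul_assoc]

theorem conj_oscFactor (lam u : ℝ) : (starRingEnd ℂ) (oscFactor lam u) = oscFactor lam (-u) := by
  rw [oscFactor, oscFactor, ← Complex.exp_conj]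
  congr 1
  simp

theorem conj_annulusAmp (η : ℝ) (ξ : EuclideanSpace ℝ (Fin d)) :
    (starRingEnd ℂ) (annulusAmp η ξ) = annulusAmp η ξ := Complex.conj_ofReal _

/-- The squared modulus of an integral is the integral of the autocorrelation. -/
theorem integral_mul_conj_integral {f : EuclideanSpace ℝ (Fin d) → ℂ} (hf : Continuous f) {R : ℝ}
    (h0 : ∀ ξ, R < ‖ξ‖ → f ξ = 0) :
    (∫ ξ, f ξ) * (starRingEnd ℂ) (∫ ξ, f ξ) =
      ∫ h, ∫ ξ, f (ξ + h) * (starRingEnd ℂ) (f ξ) := by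
  have hInt : Integrable (Function.uncurry fun h ξ : EuclideanSpace ℝ (Fin d) =>
      f (ξ + h) * (starRingEnd ℂ) (f ξ)) (volume.prod volume) := by
    refine Continuous.integrable_of_hasCompactSupport ?_ ?_
    · exact (hf.comp (by fun_prop)).mul (Complex.continuous_conj.comp (hf.comp continuous_snd))
    · refine HasCompactSupport.intro
        ((isCompact_closedBall (0 : EuclideanSpace ℝ (Fin d)) (2 * R)).prod
          (isCompact_closedBall (0 : EuclideanSpace ℝ (Fin d)) R)) ?_
      rintro ⟨h, ξ⟩ hq
      by_cases hξ : R < ‖ξ‖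
      · simp [Function.uncurry, h0 ξ hξ]
      · have : R < ‖ξ + h‖ := by
          by_contra! hle
          refine hq ⟨?_, by simpa using hξ⟩
          have : ‖h‖ ≤ ‖ξ + h‖ + ‖ξ‖ := by
            simpa using norm_sub_le (ξ + h) ξ
          simp only [Metric.mem_closedBall, dist_zero_right]
          linarith
        simp [Function.uncurry, h0 _ this]
  rw [integral_integral_swap hInt, ← integral_conj, ← integral_const_mul]
  congr 1 with ξ
  rw [integral_mul_const, integral_add_left_eq_self f ξ]

/-- The oscillatory integral over the annulus with phase `lam (‖ξ‖ ^ w + y · ξ)`. -/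
noncomputable def annulusIntegral (w η lam : ℝ) (y : EuclideanSpace ℝ (Fin d)) : ℂ :=
  ∫ ξ, oscFactor lam (smoothPow w ξ + inner ℝ y ξ) * annulusAmp η ξ

/-- Decay of the autocorrelation of the localized oscillating factor. -/
theorem exists_autocorrelation_bound (w : ℝ) (hw : 2 ≤ w) (M : ℝ) (N : ℕ) :
    ∃ C : ℝ, 0 ≤ C ∧ ∀ η ∈ Set.Icc 0 M, ∀ lam : ℝ, 0 < lam →
      ∀ h : EuclideanSpace ℝ (Fin d), h ≠ 0 →
      ‖∫ ξ, oscFactor lam (smoothPow w (ξ + h) - smoothPow w ξ) *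
        (annulusAmp η (ξ + h) * annulusAmp η ξ)‖ ≤ C * (lam * ‖h‖)⁻¹ ^ N := by
  have hc : 0 < (w * (1 / 2 : ℝ) ^ (w - 2)) ^ 2 := by
    have : 0 < w := by linarith
    positivity
  let f : (ℝ × ℝ × EuclideanSpace ℝ (Fin d)) × EuclideanSpace ℝ (Fin d) → ℂ := fun q =>
    annulusAmp q.1.1 (q.2 + q.1.2.1 • q.1.2.2) * annulusAmp q.1.1 q.2
  have hf : ContDiff ℝ ∞ f := by
    exact (ContDiff.annulusAmp (by fun_prop) (by fun_prop)).mul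
      (ContDiff.annulusAmp (by fun_prop) (by fun_prop))
  have hK : IsCompact (Set.Icc 0 M ×ˢ (Set.Icc (0 : ℝ) 4 ×ˢ
      Metric.closedBall (0 : EuclideanSpace ℝ (Fin d)) 1)) :=
    isCompact_Icc.prod (isCompact_Icc.prod (isCompact_closedBall _ _))
  obtain ⟨C, hC, H⟩ := nonstationary_phase hc 2 (contDiff_phaseQuotient (d := d) w) hf hK N
  refine ⟨C, hC, fun η hη lam hlam h hh => ?_⟩
  have hr : 0 < ‖h‖ := norm_pos_iff.2 hh
  -- Two points of the annulus are less than 4 apart, so the integrand vanishes for larger `h`.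
  -- Otherwise polar coordinates `(‖h‖, h/‖h‖)` place `h` in the compact parameter set.
  by_cases h4 : ‖h‖ ≤ 4
  · set e := ‖h‖⁻¹ • h with he
    have he1 : ‖e‖ = 1 := by
      rw [he, norm_smul, norm_inv, norm_norm, inv_mul_cancel₀ hr.ne']
    have hre : ‖h‖ • e = h := by rw [he, smul_smul, mul_inv_cancel₀ hr.ne', one_smul]
    have := H (η, ‖h‖, e) ⟨hη, ⟨hr.le, h4⟩, by simp [he1]⟩ (by
      intro ξ hξ
      by_contra hne
      have ha := norm_mem_of_annulusAmp_ne_zero (left_ne_zero_of_mul hne)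
      have hb := norm_mem_of_annulusAmp_ne_zero (right_ne_zero_of_mul hne)
      exact hξ ⟨hb.2.le, gradSq_phaseQuotient_ge hw hr he1 hb.1 ha.1⟩) (lam * ‖h‖) (by positivity)
    simp_rw [← oscFactor_mul, mul_phaseQuotient] at this
    simpa only [f, hre] using this
  · have : ∀ ξ, oscFactor lam (smoothPow w (ξ + h) - smoothPow w ξ) *
        (annulusAmp η (ξ + h) * annulusAmp η ξ) = 0 := by
      intro ξ
      by_contra hne
      have ha := norm_mem_of_annulusAmp_ne_zero (left_ne_zero_of_mul (right_ne_zero_of_mul hne))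
      have hb := norm_mem_of_annulusAmp_ne_zero (right_ne_zero_of_mul (right_ne_zero_of_mul hne))
      have : ‖h‖ ≤ ‖ξ + h‖ + ‖ξ‖ := by simpa using norm_sub_le (ξ + h) ξ
      linarith [ha.2, hb.2]
    simp_rw [this]
    rw [integral_zero, norm_zero]
    positivity

theorem continuous_annulusIntegrand (w η lam : ℝ) (y : EuclideanSpace ℝ (Fin d)) :
    Continuous fun ξ => oscFactor lam (smoothPow w ξ + inner ℝ y ξ) * annulusAmp η ξ := by
  have h1 : Continuous fun ξ : EuclideanSpace ℝ (Fin d) => smoothPow w ξ + inner ℝ y ξ :=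
    (contDiff_smoothPow w).continuous.add (by fun_prop)
  have h2 : Continuous fun ξ : EuclideanSpace ℝ (Fin d) => annulusAmp η ξ :=
    (ContDiff.annulusAmp contDiff_const contDiff_id).continuous
  exact ((contDiff_oscFactor lam).continuous.comp h1).mul h2

/-- The uniform decay `lam ^ (-d/2)`, whatever the position of the stationary point. -/
theorem exists_annulusIntegral_sq_bound (hd : 1 ≤ d) (w : ℝ) (hw : 2 ≤ w) (M : ℝ) :
    ∃ C : ℝ, 0 ≤ C ∧ ∀ η ∈ Set.Icc 0 M, ∀ lam : ℝ, 0 < lam →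
      ∀ y : EuclideanSpace ℝ (Fin d), ‖annulusIntegral w η lam y‖ ^ 2 ≤ C * lam⁻¹ ^ d := by
  -- Exponent 0 serves `lam * ‖h‖ ≤ 1`. Exponent `d + 1` serves the rest and makes the combined
  -- bound integrable over `h`.
  obtain ⟨C₀, hC₀, H₀⟩ := exists_autocorrelation_bound (d := d) w hw M 0
  obtain ⟨C₁, hC₁, H₁⟩ := exists_autocorrelation_bound (d := d) w hw M (d + 1)
  have : Nontrivial (EuclideanSpace ℝ (Fin d)) := by
    have : Nonempty (Fin d) := ⟨⟨0, hd⟩⟩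
    infer_instance
  let g : EuclideanSpace ℝ (Fin d) → ℝ := fun h => (1 + ‖h‖) ^ (-((d : ℝ) + 1))
  have hg : Integrable g := integrable_one_add_norm (by simp)
  -- The power of 2 comes from `1 + u ≤ 2` for `u ≤ 1` and `1 + u ≤ 2u` for `u ≥ 1`.
  let B := 2 ^ (d + 1) * (C₀ + C₁)
  refine ⟨B * ∫ h, g h, mul_nonneg (by positivity) (integral_nonneg fun h => by positivity),
    fun η hη lam hlam y => ?_⟩
  have hpt : ∀ h : EuclideanSpace ℝ (Fin d), h ≠ 0 →
      ‖∫ ξ, oscFactor lam (smoothPow w (ξ + h) - smoothPow w ξ) *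
        (annulusAmp η (ξ + h) * annulusAmp η ξ)‖ ≤ B * g (lam • h) := by
    intro h hh
    have h0 := H₀ η hη lam hlam h hh
    have h1 := H₁ η hη lam hlam h hh
    have hu : 0 < lam * ‖h‖ := mul_pos hlam (norm_pos_iff.2 hh)
    have hgu : g (lam • h) = ((1 + lam * ‖h‖) ^ (d + 1))⁻¹ := by
      simp only [g, norm_smul, Real.norm_of_nonneg hlam.le]
      rw [Real.rpow_neg (by positivity)]
      norm_cast
    rw [hgu]
    set u := lam * ‖h‖
    set A := ‖∫ ξ, oscFactor lam (smoothPow w (ξ + h) - smoothPow w ξ) *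
        (annulusAmp η (ξ + h) * annulusAmp η ξ)‖
    rw [← div_eq_mul_inv, le_div_iff₀ (by positivity)]
    rw [pow_zero, mul_one] at h0
    have hA : 0 ≤ A := norm_nonneg _
    rcases le_total u 1 with hu1 | hu1
    · calc A * (1 + u) ^ (d + 1) ≤ C₀ * 2 ^ (d + 1) := by gcongr; linarith
        _ ≤ B := by
          simp only [B]
          nlinarith [mul_nonneg hC₁ (by positivity : (0 : ℝ) ≤ 2 ^ (d + 1))]
    · calc A * (1 + u) ^ (d + 1) ≤ (C₁ * u⁻¹ ^ (d + 1)) * (2 * u) ^ (d + 1) := by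
            gcongr; linarith
        _ = C₁ * 2 ^ (d + 1) := by
          rw [mul_pow, inv_pow]
          field_simp
        _ ≤ B := by
          simp only [B]
          nlinarith [mul_nonneg hC₀ (by positivity : (0 : ℝ) ≤ 2 ^ (d + 1))]
  have hsq : ‖annulusIntegral w η lam y‖ ^ 2 =
      ‖annulusIntegral w η lam y * (starRingEnd ℂ) (annulusIntegral w η lam y)‖ := by
    rw [norm_mul, RCLike.norm_conj, sq]
  rw [hsq, annulusIntegral, integral_mul_conj_integral (continuous_annulusIntegrand w η lam y)
    (R := 2) (fun ξ hξ => by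
      by_contra hne
      exact absurd (norm_mem_of_annulusAmp_ne_zero (right_ne_zero_of_mul hne)).2 (not_lt.2 hξ.le))]
  have hInt : Integrable fun h : EuclideanSpace ℝ (Fin d) => B * g (lam • h) :=
    (hg.comp_smul hlam.ne').const_mul B
  have hval : ∫ h : EuclideanSpace ℝ (Fin d), B * g (lam • h) = B * (∫ h, g h) * lam⁻¹ ^ d := by
    rw [integral_const_mul, Measure.integral_comp_smul_of_nonneg volume g lam (hR := hlam.le)]
    simp only [finrank_euclideanSpace, Fintype.card_fin, smul_eq_mul, inv_pow]
    ring
  rw [← hval]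
  refine norm_integral_le_of_norm_le hInt ?_
  have hne : ∀ᵐ h : EuclideanSpace ℝ (Fin d), h ≠ 0 :=
    compl_mem_ae_iff.2 (measure_singleton 0)
  filter_upwards [hne] with h hh
  refine le_trans (le_of_eq ?_) (hpt h hh)
  -- The linear part of the phase contributes `e^{iλ y·h}`, independent of `ξ` and unimodular. This
  -- is the source of uniformity in `y`.
  have : ∀ ξ : EuclideanSpace ℝ (Fin d),
      oscFactor lam (smoothPow w (ξ + h) + inner ℝ y (ξ + h)) * annulusAmp η (ξ + h) *
      (starRingEnd ℂ) (oscFactor lam (smoothPow w ξ + inner ℝ y ξ) * annulusAmp η ξ) =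
      oscFactor lam (inner ℝ y h) * (oscFactor lam (smoothPow w (ξ + h) - smoothPow w ξ) *
        (annulusAmp η (ξ + h) * annulusAmp η ξ)) := by
    intro ξ
    rw [map_mul, conj_oscFactor, conj_annulusAmp]
    have e : oscFactor lam (smoothPow w (ξ + h) + inner ℝ y (ξ + h)) *
        oscFactor lam (-(smoothPow w ξ + inner ℝ y ξ)) =
        oscFactor lam (inner ℝ y h) * oscFactor lam (smoothPow w (ξ + h) - smoothPow w ξ) := by
      rw [← oscFactor_add, ← oscFactor_add, inner_add_right]
      congr 1
      ring
    linear_combination (annulusAmp η (ξ + h) * annulusAmp η ξ) * e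
  simp_rw [this]
  rw [integral_const_mul, norm_mul, norm_oscFactor, one_mul]

end StationaryPhase

/-! ### Rapid decay away from the critical scales -/

section Noncritical

variable {d : ℕ}

/-- The linear perturbation of the phase is so small or so large that the gradient of
`‖ξ‖ ^ w + y · ξ` does not vanish on the annulus. -/
def Noncritical (w r : ℝ) : Prop := r ≤ w * (1 / 2) ^ w ∨ w * 2 ^ w ≤ r

/-- The phase `s ‖ξ‖ ^ w + y · ξ` as a function of `((η, s, y), ξ)`. -/
noncomputable def pencilPhase (w : ℝ)
    (q : (ℝ × ℝ × EuclideanSpace ℝ (Fin d)) × EuclideanSpace ℝ (Fin d)) : ℝ :=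
  q.1.2.1 * smoothPow w q.2 + inner ℝ q.1.2.2 q.2

theorem contDiff_pencilPhase (w : ℝ) : ContDiff ℝ ∞ (pencilPhase (d := d) w) := by
  have h1 : ContDiff ℝ ∞ fun q : (ℝ × ℝ × EuclideanSpace ℝ (Fin d)) × EuclideanSpace ℝ (Fin d) =>
      smoothPow w q.2 := (contDiff_smoothPow w).comp contDiff_snd
  exact (ContDiff.mul (by fun_prop) h1).add (ContDiff.inner ℝ (by fun_prop) (by fun_prop))

theorem fderiv_pencilPhase_slice {w : ℝ} (hw : 1 < w) (η s : ℝ) (y : EuclideanSpace ℝ (Fin d))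
    {ξ : EuclideanSpace ℝ (Fin d)} (hξ : 1 / 4 < ‖ξ‖) (v : EuclideanSpace ℝ (Fin d)) :
    fderiv ℝ (fun ζ => pencilPhase w ((η, s, y), ζ)) ξ v =
      s * (w * ‖ξ‖ ^ (w - 2) * inner ℝ ξ v) + inner ℝ y v := by
  have h1 := ((contDiff_smoothPow (d := d) w).differentiable (by simp) ξ).hasFDerivAt
  have h2 : HasFDerivAt (fun ζ => pencilPhase w ((η, s, y), ζ))
      (s • fderiv ℝ (smoothPow w) ξ + innerSL ℝ y) ξ :=
    (h1.const_mul s).add (innerSL ℝ y).hasFDerivAt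
  rw [h2.fderiv]
  simp [fderiv_smoothPow hw hξ]

theorem rpow_sub_two_mul {w r : ℝ} (hr : 0 < r) : r ^ (w - 2) * r = r ^ (w - 1) := by
  rw [show w - 1 = (w - 2) + 1 by ring, Real.rpow_add hr, Real.rpow_one]

/-- On the annulus the gradient of `‖ξ‖ ^ w` has length `w‖ξ‖^(w-1) > 2 · w(1/2)^w`, more than twice
the bound on `‖y‖`. Differentiating along `ξ` keeps at least half of it. -/
theorem gradSq_pencilPhase_small {w η : ℝ} (hw : 2 ≤ w) {y ξ : EuclideanSpace ℝ (Fin d)}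
    (hy : ‖y‖ ≤ w * (1 / 2) ^ w) (hξ : 1 / 2 < ‖ξ‖) :
    (w * (1 / 2) ^ w) ^ 2 ≤ gradSq (pencilPhase w) ((η, 1, y), ξ) := by
  have h0 : 0 < ‖ξ‖ := by linarith
  have hsq := sq_fderiv_slice_le_gradSq (contDiff_pencilPhase (d := d) w) (η, 1, y) ξ ξ
  rw [fderiv_pencilPhase_slice (by linarith) η 1 y (by linarith), real_inner_self_eq_norm_sq,
    one_mul] at hsq
  have h1 : (1 / 2 : ℝ) ^ (w - 1) ≤ ‖ξ‖ ^ (w - 1) :=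
    Real.rpow_le_rpow (by norm_num) hξ.le (by linarith)
  have h2 : (1 / 2 : ℝ) ^ (w - 1) = 2 * (1 / 2) ^ w := by
    rw [Real.rpow_sub (by norm_num), Real.rpow_one]; ring
  have h3 : -(‖y‖ * ‖ξ‖) ≤ inner ℝ y ξ := (abs_le.1 (abs_real_inner_le_norm y ξ)).1
  have h4 : ‖ξ‖ ^ (w - 2) * ‖ξ‖ ^ 2 = ‖ξ‖ ^ (w - 1) * ‖ξ‖ := by
    rw [← rpow_sub_two_mul h0]; ring
  have h5 : w * (1 / 2) ^ w * ‖ξ‖ ≤ w * ‖ξ‖ ^ (w - 2) * ‖ξ‖ ^ 2 + inner ℝ y ξ := by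
    rw [mul_assoc w (‖ξ‖ ^ (w - 2)), h4]
    rw [h2] at h1
    have h6 : w * (2 * (1 / 2) ^ w) ≤ w * ‖ξ‖ ^ (w - 1) :=
      mul_le_mul_of_nonneg_left h1 (by linarith)
    nlinarith [mul_le_mul_of_nonneg_right h6 h0.le, mul_le_mul_of_nonneg_right hy h0.le]
  have h7 : (w * (1 / 2) ^ w * ‖ξ‖) ^ 2 ≤ gradSq (pencilPhase w) ((η, 1, y), ξ) * ‖ξ‖ ^ 2 :=
    le_trans (by gcongr) hsq
  rw [mul_pow] at h7
  exact le_of_mul_le_mul_right h7 (by positivity)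

/-- Along `e` the linear term has derivative 1, while the power term contributes at most `s w
2^(w-1) ≤ 1/2` in absolute value. -/
theorem gradSq_pencilPhase_large {w η s : ℝ} (hw : 2 ≤ w) (hs : 0 ≤ s) (hs' : s * (w * 2 ^ w) ≤ 1)
    {e ξ : EuclideanSpace ℝ (Fin d)} (he : ‖e‖ = 1) (hξ : 1 / 2 < ‖ξ‖) (hξ' : ‖ξ‖ < 2) :
    (1 / 2 : ℝ) ^ 2 ≤ gradSq (pencilPhase w) ((η, s, e), ξ) := by
  have h0 : 0 < ‖ξ‖ := by linarith
  have hsq := sq_fderiv_slice_le_gradSq (contDiff_pencilPhase (d := d) w) (η, s, e) ξ e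
  rw [fderiv_pencilPhase_slice (by linarith) η s e (by linarith), real_inner_self_eq_norm_sq,
    he, one_pow, mul_one] at hsq
  refine le_trans ?_ hsq
  have h3 : -‖ξ‖ ≤ inner ℝ ξ e := by
    have := (abs_le.1 (abs_real_inner_le_norm ξ e)).1
    rwa [he, mul_one] at this
  have h1 : ‖ξ‖ ^ (w - 1) ≤ 2 ^ (w - 1) := Real.rpow_le_rpow h0.le hξ'.le (by linarith)
  have h2 : (2 : ℝ) ^ (w - 1) = 2 ^ w / 2 := by
    rw [Real.rpow_sub (by norm_num), Real.rpow_one]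
  have hsw : 0 ≤ s * w := mul_nonneg hs (by linarith)
  have h4 : -(1 / 2) ≤ s * (w * ‖ξ‖ ^ (w - 2) * inner ℝ ξ e) := by
    have h5 : s * w * ‖ξ‖ ^ (w - 2) * (-‖ξ‖) ≤ s * w * ‖ξ‖ ^ (w - 2) * inner ℝ ξ e :=
      mul_le_mul_of_nonneg_left h3 (by positivity)
    have h6 : s * w * (‖ξ‖ ^ (w - 2) * ‖ξ‖) ≤ s * w * (2 ^ w / 2) := by
      rw [rpow_sub_two_mul h0, ← h2]
      exact mul_le_mul_of_nonneg_left h1 hsw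
    nlinarith
  gcongr
  linarith

/-- Rapid decay when the phase has no stationary point on the annulus. -/
theorem exists_annulusIntegral_noncritical_bound (w : ℝ) (hw : 2 ≤ w) (M : ℝ) (N : ℕ) :
    ∃ C : ℝ, 0 ≤ C ∧ ∀ η ∈ Set.Icc 0 M, ∀ lam : ℝ, 0 < lam →
      ∀ y : EuclideanSpace ℝ (Fin d), Noncritical w ‖y‖ →
      ‖annulusIntegral w η lam y‖ ≤ C * lam⁻¹ ^ N := by
  set c₁ := w * (1 / 2 : ℝ) ^ w with hc₁
  have hc₁pos : 0 < c₁ := by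
    have : 0 < w := by linarith
    positivity
  have hc : 0 < min (c₁ ^ 2) ((1 / 2 : ℝ) ^ 2) := lt_min (by positivity) (by positivity)
  have hf : ContDiff ℝ ∞ fun q : (ℝ × ℝ × EuclideanSpace ℝ (Fin d)) ×
      EuclideanSpace ℝ (Fin d) => annulusAmp q.1.1 q.2 :=
    ContDiff.annulusAmp (by fun_prop) (by fun_prop)
  -- One compact set holds both regimes: `(1, y)` for small `y`, and `(‖y‖⁻¹, y/‖y‖)` for large `y`,
  -- where `‖y‖` is absorbed into `lam`.
  have hK : IsCompact (Set.Icc 0 M ×ˢ (Set.Icc (0 : ℝ) 1 ×ˢ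
      Metric.closedBall (0 : EuclideanSpace ℝ (Fin d)) (max c₁ 1))) :=
    isCompact_Icc.prod (isCompact_Icc.prod (isCompact_closedBall _ _))
  obtain ⟨C, hC, H⟩ := nonstationary_phase hc 2 (contDiff_pencilPhase (d := d) w) hf hK N
  refine ⟨C, hC, fun η hη lam hlam y hy => ?_⟩
  rcases hy with hy | hy
  · have := H (η, 1, y) ⟨hη, ⟨zero_le_one, le_rfl⟩, by
        rw [Metric.mem_closedBall, dist_zero_right]; exact le_max_of_le_left hy⟩ (by
      intro ξ hξ
      by_contra hne
      have ha := norm_mem_of_annulusAmp_ne_zero hne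
      exact hξ ⟨ha.2.le, (min_le_left _ _).trans (gradSq_pencilPhase_small hw hy ha.1)⟩) lam hlam
    simpa only [annulusIntegral, pencilPhase, one_mul] using this
  · have hw1 : 1 ≤ w * 2 ^ w := by
      have : (1 : ℝ) ≤ 2 ^ w := Real.one_le_rpow (by norm_num) (by linarith)
      nlinarith
    have hy1 : 1 ≤ ‖y‖ := hw1.trans hy
    have hy0 : 0 < ‖y‖ := by linarith
    have he : ‖‖y‖⁻¹ • y‖ = 1 := by
      rw [norm_smul, norm_inv, norm_norm, inv_mul_cancel₀ hy0.ne']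
    have hs' : ‖y‖⁻¹ * (w * 2 ^ w) ≤ 1 := by
      rw [inv_mul_le_iff₀ hy0, mul_one]; exact hy
    have := H (η, ‖y‖⁻¹, ‖y‖⁻¹ • y) ⟨hη, ⟨by positivity, inv_le_one_of_one_le₀ hy1⟩, by
        rw [Metric.mem_closedBall, dist_zero_right, he]; exact le_max_right _ _⟩ (by
      intro ξ hξ
      by_contra hne
      have ha := norm_mem_of_annulusAmp_ne_zero hne
      exact hξ ⟨ha.2.le, (min_le_right _ _).trans
        (gradSq_pencilPhase_large hw (by positivity) hs' he ha.1 ha.2)⟩) (lam * ‖y‖)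
      (by positivity)
    have hphase : ∀ ξ : EuclideanSpace ℝ (Fin d),
        ‖y‖ * pencilPhase w ((η, ‖y‖⁻¹, ‖y‖⁻¹ • y), ξ) = smoothPow w ξ + inner ℝ y ξ := by
      intro ξ
      simp only [pencilPhase, real_inner_smul_left]
      field_simp
    simp_rw [← oscFactor_mul, hphase] at this
    refine this.trans ?_
    gcongr
    exact le_mul_of_one_le_right hlam.le hy1

end Noncritical

/-! ### Dyadic pieces of the kernel and counting of critical scales -/

section Dyadic

variable {d : ℕ}

/-- The symbol `e^{it‖ξ‖^w} ‖ξ‖^η`. -/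
noncomputable def dispSymbol (w η t : ℝ) (ξ : EuclideanSpace ℝ (Fin d)) : ℂ :=
  Complex.exp (Complex.I * ((t * ‖ξ‖ ^ w : ℝ) : ℂ)) * ((‖ξ‖ ^ η : ℝ) : ℂ)

theorem norm_dispSymbol (w η t : ℝ) (ξ : EuclideanSpace ℝ (Fin d)) :
    ‖dispSymbol w η t ξ‖ = ‖ξ‖ ^ η := by
  rw [dispSymbol, norm_mul, mul_comm Complex.I, Complex.norm_exp_ofReal_mul_I, one_mul,
    Complex.norm_real, Real.norm_of_nonneg (by positivity)]

theorem continuous_dispSymbol {w η : ℝ} (hw : 0 ≤ w) (hη : 0 ≤ η) (t : ℝ) :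
    Continuous (dispSymbol (d := d) w η t) := by
  have h1 : Continuous fun ξ : EuclideanSpace ℝ (Fin d) => ‖ξ‖ ^ w :=
    continuous_norm.rpow_const fun _ => Or.inr hw
  have h2 : Continuous fun ξ : EuclideanSpace ℝ (Fin d) => ‖ξ‖ ^ η :=
    continuous_norm.rpow_const fun _ => Or.inr hη
  unfold dispSymbol
  fun_prop

/-- The contribution of the frequencies `‖ξ‖ ~ R` to the kernel. -/
theorem invFourier_annulus_eq {w η : ℝ} {R : ℝ} (hR : 0 < R) (x : EuclideanSpace ℝ (Fin d)) :
    invFourier (fun ξ => dispSymbol w η 1 ξ * (annulusCutoff (R⁻¹ • ξ) : ℂ)) x =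
      ((R ^ d * R ^ η : ℝ) : ℂ) * annulusIntegral w η (R ^ w) (R ^ (1 - w) • x) := by
  -- Under `ξ = R ζ` both terms of the phase carry the factor `R ^ w`, because `R = R^w · R^(1-w)`.
  let g : EuclideanSpace ℝ (Fin d) → ℂ := fun ζ => ((R ^ η : ℝ) : ℂ) *
    (oscFactor (R ^ w) (smoothPow w ζ + inner ℝ (R ^ (1 - w) • x) ζ) * annulusAmp η ζ)
  have hpt : ∀ ξ, Complex.exp (Complex.I * ((inner ℝ ξ x : ℝ) : ℂ)) *
      (dispSymbol w η 1 ξ * (annulusCutoff (R⁻¹ • ξ) : ℂ)) = g (R⁻¹ • ξ) := by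
    intro ξ
    obtain ⟨ζ, rfl⟩ : ∃ ζ, ξ = R • ζ :=
      ⟨R⁻¹ • ξ, by rw [smul_smul, mul_inv_cancel₀ hR.ne', one_smul]⟩
    rw [smul_smul, inv_mul_cancel₀ hR.ne', one_smul]
    by_cases hζ : annulusAmp η ζ = 0
    · have : annulusCutoff ζ = 0 := by
        rw [annulusAmp, Complex.ofReal_eq_zero, mul_eq_zero] at hζ
        exact hζ.resolve_right (Real.exp_pos _).ne'
      simp [g, hζ, this]
    · have h := (norm_mem_of_annulusAmp_ne_zero hζ).1
      have hn : ‖R • ζ‖ = R * ‖ζ‖ := by rw [norm_smul, Real.norm_of_nonneg hR.le]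
      have hRw : R ^ w * R ^ (1 - w) = R := by
        rw [← Real.rpow_add hR, show w + (1 - w) = 1 by ring, Real.rpow_one]
      simp only [g, dispSymbol, annulusAmp, oscFactor]
      rw [smoothPow_of_le w (by linarith), smoothPow_of_le η (by linarith), hn,
        Real.mul_rpow hR.le (norm_nonneg _), Real.mul_rpow hR.le (norm_nonneg _),
        real_inner_smul_left, real_inner_smul_left, real_inner_comm ζ x, mul_add,
        ← mul_assoc (R ^ w) (R ^ (1 - w)), hRw]
      push_cast
      rw [mul_add, Complex.exp_add, one_mul]
      ring
  rw [invFourier]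
  simp_rw [hpt]
  rw [Measure.integral_comp_inv_smul volume g R, integral_const_mul, ← annulusIntegral]
  simp only [finrank_euclideanSpace, Fintype.card_fin, Complex.real_smul]
  rw [abs_of_pos (by positivity)]
  push_cast
  ring

/-- Bounds for the dyadic pieces of the kernel, uniformly in the exponent `η`. -/
theorem exists_dyadic_bound (hd : 1 ≤ d) (w : ℝ) (hw : 2 ≤ w) :
    ∃ C : ℝ, 0 ≤ C ∧ ∀ η ∈ Set.Icc 0 (d * (w / 2 - 1)), ∀ R : ℝ, 1 ≤ R →
      ∀ x : EuclideanSpace ℝ (Fin d),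
      ‖invFourier (fun ξ => dispSymbol w η 1 ξ * (annulusCutoff (R⁻¹ • ξ) : ℂ)) x‖ ≤ C ∧
      (Noncritical w (R ^ (1 - w) * ‖x‖) →
        ‖invFourier (fun ξ => dispSymbol w η 1 ξ * (annulusCutoff (R⁻¹ • ξ) : ℂ)) x‖ ≤
          C * R⁻¹) := by
  set M := (d : ℝ) * (w / 2 - 1) with hM
  -- This many integrations by parts beat `R^(d+η)` with a spare factor `R⁻¹`.
  obtain ⟨N, hN⟩ := exists_nat_ge ((d : ℝ) + M + 1)
  obtain ⟨C₁, hC₁, H₁⟩ := exists_annulusIntegral_sq_bound hd w hw M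
  obtain ⟨C₂, hC₂, H₂⟩ := exists_annulusIntegral_noncritical_bound (d := d) w hw M N
  refine ⟨max (√C₁) C₂, le_max_of_le_right hC₂, fun η hη R hR x => ?_⟩
  have hR0 : 0 < R := by linarith
  have hpos : 0 < R ^ w := by positivity
  rw [invFourier_annulus_eq hR0, norm_mul, Complex.norm_real, Real.norm_of_nonneg (by positivity)]
  constructor
  · refine le_trans ?_ (le_max_left _ _)
    refine Real.le_sqrt_of_sq_le ?_
    rw [mul_pow]
    calc (R ^ d * R ^ η) ^ 2 * _ ≤ (R ^ d * R ^ η) ^ 2 * (C₁ * (R ^ w)⁻¹ ^ d) := by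
          gcongr; exact H₁ η hη _ hpos _
      _ = C₁ * R ^ (2 * (d + η) - w * d) := by
          rw [Real.rpow_sub hR0, Real.rpow_mul hR0.le w, Real.rpow_natCast, mul_comm 2,
            Real.rpow_mul hR0.le, Real.rpow_add hR0, Real.rpow_natCast, inv_pow,
            show ((2 : ℝ)) = ((2 : ℕ) : ℝ) by norm_num, Real.rpow_natCast]
          ring
      _ ≤ C₁ * 1 := by
          gcongr
          -- `2(d+η) - wd ≤ 0` is precisely `η ≤ d(w/2 - 1)`.
          refine Real.rpow_le_one_of_one_le_of_nonpos hR ?_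
          have := hη.2
          rw [hM] at this
          nlinarith
      _ = C₁ := mul_one _
  · intro hx
    have hnx : ‖R ^ (1 - w) • x‖ = R ^ (1 - w) * ‖x‖ := by
      rw [norm_smul, Real.norm_of_nonneg (by positivity)]
    calc R ^ d * R ^ η * _ ≤ R ^ d * R ^ η * (C₂ * (R ^ w)⁻¹ ^ N) := by
          gcongr; exact H₂ η hη _ hpos _ (by rwa [hnx])
      _ = C₂ * R ^ (d + η - w * N) := by
          rw [Real.rpow_sub hR0, Real.rpow_mul hR0.le w, Real.rpow_natCast,
            Real.rpow_add hR0, Real.rpow_natCast, inv_pow]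
          ring
      _ ≤ C₂ * R ^ (-1 : ℝ) := by
          gcongr
          have := hη.2
          have hN0 : (0 : ℝ) ≤ N := Nat.cast_nonneg N
          nlinarith
      _ ≤ max (√C₁) C₂ * R⁻¹ := by
          rw [Real.rpow_neg_one]
          gcongr
          exact le_max_right _ _

/-- Critical dyadic scales are close to each other. -/
theorem critical_scale_lt {w r : ℝ} (hw : 2 ≤ w) {j k : ℕ}
    (hj : ¬ Noncritical w (((2 : ℝ) ^ j) ^ (1 - w) * r))
    (hk : ¬ Noncritical w (((2 : ℝ) ^ k) ^ (1 - w) * r)) : k < j + 4 := by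
  simp only [Noncritical, not_or, not_le] at hj hk
  by_contra! h
  have hw0 : 0 < w := by linarith
  have h1 : ((2 : ℝ) ^ k) ^ (1 - w) = ((2 : ℝ) ^ j) ^ (1 - w) * ((2 : ℝ) ^ (k - j)) ^ (1 - w) := by
    rw [← Real.mul_rpow (by positivity) (by positivity), ← pow_add]
    congr 2
    omega
  -- Four doublings suffice because `4(1-w) ≤ -2w` for `w ≥ 2`. The factor `2^(-2w)` carries the
  -- upper threshold `w 2^w` to the lower one `w 2^(-w)`.
  have h2 : ((2 : ℝ) ^ (k - j)) ^ (1 - w) ≤ 2 ^ (-(2 * w)) := by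
    rw [← Real.rpow_natCast, ← Real.rpow_mul (by norm_num)]
    refine Real.rpow_le_rpow_of_exponent_le (by norm_num) ?_
    have : (4 : ℝ) ≤ ((k - j : ℕ) : ℝ) := by exact_mod_cast (by omega : 4 ≤ k - j)
    nlinarith
  have h3 : (2 : ℝ) ^ (-(2 * w)) * 2 ^ w = (1 / 2) ^ w := by
    rw [← Real.rpow_add (by norm_num), one_div, Real.inv_rpow (by norm_num),
      ← Real.rpow_neg (by norm_num)]
    congr 1; ring
  have hpos : 0 ≤ ((2 : ℝ) ^ j) ^ (1 - w) * r :=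
    le_trans (by positivity) hj.1.le
  have : ((2 : ℝ) ^ k) ^ (1 - w) * r ≤ w * (1 / 2) ^ w := by
    calc ((2 : ℝ) ^ k) ^ (1 - w) * r
        = ((2 : ℝ) ^ j) ^ (1 - w) * r * ((2 : ℝ) ^ (k - j)) ^ (1 - w) := by rw [h1]; ring
      _ ≤ (w * 2 ^ w) * 2 ^ (-(2 * w)) :=
          mul_le_mul hj.2.le h2 (by positivity) (by positivity)
      _ = w * (1 / 2) ^ w := by rw [← h3]; ring
  linarith [hk.1]

-- All critical indices lie among the four that start at the least one. Hence only boundedly many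
-- pieces lack geometric decay, whatever `x` is.
open scoped Classical in
theorem card_critical_scales_le {w : ℝ} (hw : 2 ≤ w) (r : ℝ) (s : Finset ℕ) :
    (s.filter fun j : ℕ => ¬ Noncritical w (((2 : ℝ) ^ (j + 1)) ^ (1 - w) * r)).card ≤ 4 := by
  set T := s.filter fun j : ℕ => ¬ Noncritical w (((2 : ℝ) ^ (j + 1)) ^ (1 - w) * r)
  rcases T.eq_empty_or_nonempty with h | h
  · simp [h]
  · have hmin := T.min'_mem h
    have : T ⊆ Finset.Ico (T.min' h) (T.min' h + 4) := fun k hk => by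
      rw [Finset.mem_Ico]
      refine ⟨T.min'_le k hk, ?_⟩
      have := critical_scale_lt hw (Finset.mem_filter.1 hmin).2 (Finset.mem_filter.1 hk).2
      omega
    simpa using Finset.card_le_card this

end Dyadic

/-! ### Elementary properties of the inverse Fourier integral -/

section InvFourier

variable {d : ℕ}

theorem norm_exp_I_inner (x ξ : EuclideanSpace ℝ (Fin d)) :
    ‖Complex.exp (Complex.I * ((inner ℝ x ξ : ℝ) : ℂ))‖ = 1 := by
  rw [mul_comm, Complex.norm_exp_ofReal_mul_I]

theorem integrable_exp_I_inner_mul {g : EuclideanSpace ℝ (Fin d) → ℂ} (hg : Integrable g)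
    (x : EuclideanSpace ℝ (Fin d)) :
    Integrable fun ξ => Complex.exp (Complex.I * ((inner ℝ ξ x : ℝ) : ℂ)) * g ξ := by
  refine hg.bdd_mul (c := 1) ?_ (ae_of_all _ fun ξ => (norm_exp_I_inner ξ x).le)
  exact Continuous.aestronglyMeasurable (by fun_prop)

theorem continuous_invFourier {g : EuclideanSpace ℝ (Fin d) → ℂ} (hg : Integrable g) :
    Continuous (invFourier g) := by
  refine continuous_of_dominated (bound := fun ξ => ‖g ξ‖)
    (fun x => (integrable_exp_I_inner_mul hg x).aestronglyMeasurable)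
    (fun x => ae_of_all _ fun ξ => ?_) hg.norm (ae_of_all _ fun ξ => by fun_prop)
  rw [norm_mul, norm_exp_I_inner, one_mul]

theorem invFourier_sub {f g : EuclideanSpace ℝ (Fin d) → ℂ} (hf : Integrable f)
    (hg : Integrable g) (x : EuclideanSpace ℝ (Fin d)) :
    invFourier f x - invFourier g x = invFourier (fun ξ => f ξ - g ξ) x := by
  rw [invFourier, invFourier, invFourier, ← integral_sub (integrable_exp_I_inner_mul hf x)
    (integrable_exp_I_inner_mul hg x)]
  congr 1 with ξ
  ring

/-- The multiplication formula. -/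
theorem integral_invFourier_mul {g φ : EuclideanSpace ℝ (Fin d) → ℂ} (hg : Integrable g)
    (hφ : Integrable φ) : ∫ ξ, g ξ * invFourier φ ξ = ∫ x, invFourier g x * φ x := by
  have hInt : Integrable (Function.uncurry fun ξ x : EuclideanSpace ℝ (Fin d) =>
      Complex.exp (Complex.I * ((inner ℝ ξ x : ℝ) : ℂ)) * (g ξ * φ x)) (volume.prod volume) := by
    refine (hg.mul_prod hφ).bdd_mul (c := 1) ?_
      (ae_of_all _ fun q => (norm_exp_I_inner q.1 q.2).le)
    exact Continuous.aestronglyMeasurable (by fun_prop)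
  calc ∫ ξ, g ξ * invFourier φ ξ
      = ∫ ξ, ∫ x, Complex.exp (Complex.I * ((inner ℝ ξ x : ℝ) : ℂ)) * (g ξ * φ x) := by
        congr 1 with ξ
        rw [invFourier, ← integral_const_mul]
        congr 1 with x
        rw [real_inner_comm]
        ring
    _ = ∫ x, ∫ ξ, Complex.exp (Complex.I * ((inner ℝ ξ x : ℝ) : ℂ)) * (g ξ * φ x) :=
        integral_integral_swap hInt
    _ = ∫ x, invFourier g x * φ x := by
        congr 1 with x
        rw [invFourier, ← integral_mul_const]
        congr 1 with ξ
        ring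

end InvFourier

/-! ### Construction of the kernel as a limit of truncations -/

section Kernel

variable {d : ℕ}

/-- The symbol cut off to the ball of radius `2 ^ (J + 1)`. -/
noncomputable def truncSymbol (w η : ℝ) (J : ℕ) (ξ : EuclideanSpace ℝ (Fin d)) : ℂ :=
  dispSymbol w η 1 ξ * (ballCutoff d (((2 : ℝ) ^ J)⁻¹ • ξ) : ℂ)

theorem integrable_truncSymbol {w η : ℝ} (hw : 0 ≤ w) (hη : 0 ≤ η) (J : ℕ) :
    Integrable (truncSymbol (d := d) w η J) := by
  refine integrable_slice (R := 2 ^ J * 2) ?_ fun ξ hξ => ?_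
  · exact (continuous_dispSymbol hw hη 1).mul (Complex.continuous_ofReal.comp
      ((ballCutoff d).continuous.comp (continuous_const_smul _)))
  · rw [truncSymbol, ballCutoff_of_ge, Complex.ofReal_zero, mul_zero]
    rw [norm_smul, norm_inv, norm_pow, Real.norm_ofNat, le_inv_mul_iff₀ (by positivity)]
    exact hξ.le

theorem norm_truncSymbol_le (w η : ℝ) (J : ℕ) (ξ : EuclideanSpace ℝ (Fin d)) :
    ‖truncSymbol w η J ξ‖ ≤ ‖dispSymbol w η 1 ξ‖ := by
  rw [truncSymbol, norm_mul, Complex.norm_real, Real.norm_of_nonneg (ballCutoff d).nonneg]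
  exact mul_le_of_le_one_right (norm_nonneg _) (ballCutoff d).le_one

theorem tendsto_truncSymbol (w η : ℝ) (ξ : EuclideanSpace ℝ (Fin d)) :
    Tendsto (fun J => truncSymbol w η J ξ) atTop (𝓝 (dispSymbol w η 1 ξ)) := by
  refine tendsto_const_nhds.congr' ?_
  have h := (tendsto_pow_atTop_atTop_of_one_lt (one_lt_two (α := ℝ))).eventually_ge_atTop ‖ξ‖
  filter_upwards [h] with J hJ
  rw [truncSymbol, ballCutoff_of_le, Complex.ofReal_one, mul_one]
  rw [norm_smul, norm_inv, norm_pow, Real.norm_ofNat, inv_mul_le_iff₀ (by positivity), mul_one]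
  exact hJ

/-- The telescoping identity: consecutive truncations differ by the dyadic piece at scale `2 ^ (J +
1)`. -/
theorem truncSymbol_succ_sub (w η : ℝ) (J : ℕ) (ξ : EuclideanSpace ℝ (Fin d)) :
    truncSymbol w η (J + 1) ξ - truncSymbol w η J ξ =
      dispSymbol w η 1 ξ * (annulusCutoff (((2 : ℝ) ^ (J + 1))⁻¹ • ξ) : ℂ) := by
  have : (2 : ℝ) • ((2 : ℝ) ^ (J + 1))⁻¹ • ξ = ((2 : ℝ) ^ J)⁻¹ • ξ := by
    rw [smul_smul]
    congr 1
    rw [pow_succ]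
    field_simp
  rw [truncSymbol, truncSymbol, annulusCutoff, this]
  push_cast
  ring

theorem norm_invFourier_truncSymbol_zero_le {w η M : ℝ} (hη : η ∈ Set.Icc 0 M)
    (x : EuclideanSpace ℝ (Fin d)) :
    ‖invFourier (truncSymbol w η 0) x‖ ≤
      2 ^ M * (volume : Measure (EuclideanSpace ℝ (Fin d))).real (Metric.closedBall 0 2) := by
  have h0 : ∀ ξ ∉ Metric.closedBall (0 : EuclideanSpace ℝ (Fin d)) 2,
      Complex.exp (Complex.I * ((inner ℝ ξ x : ℝ) : ℂ)) * truncSymbol w η 0 ξ = 0 := by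
    intro ξ hξ
    rw [truncSymbol, ballCutoff_of_ge, Complex.ofReal_zero, mul_zero, mul_zero]
    simpa using (not_le.1 (by simpa using hξ : ¬ ‖ξ‖ ≤ 2)).le
  rw [invFourier, ← setIntegral_eq_integral_of_forall_compl_eq_zero h0]
  refine norm_setIntegral_le_of_norm_le_const measure_closedBall_lt_top fun ξ hξ => ?_
  rw [norm_mul, norm_exp_I_inner, one_mul]
  refine (norm_truncSymbol_le w η 0 ξ).trans ?_
  rw [norm_dispSymbol]
  have hξ' : ‖ξ‖ ≤ 2 := by simpa using hξ
  exact (Real.rpow_le_rpow (norm_nonneg _) hξ' hη.1).trans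
    (Real.rpow_le_rpow_of_exponent_le one_le_two hη.2)

theorem sum_half_pow_succ_le (n : ℕ) : ∑ j ∈ Finset.range n, ((2 : ℝ) ^ (j + 1))⁻¹ ≤ 1 := by
  have : ∀ n : ℕ, ∑ j ∈ Finset.range n, ((2 : ℝ) ^ (j + 1))⁻¹ = 1 - (2 ^ n)⁻¹ := by
    intro n
    induction n with
    | zero => simp
    | succ n ih =>
      rw [Finset.sum_range_succ, ih, pow_succ]
      field_simp
      ring
  rw [this]
  have : (0 : ℝ) ≤ (2 ^ n)⁻¹ := by positivity
  linarith

/-- The truncated kernels are uniformly bounded and converge to a bounded continuous function. -/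
theorem exists_kernel (hd : 1 ≤ d) (w : ℝ) (hw : 2 ≤ w) :
    ∃ C : ℝ, ∀ η ∈ Set.Icc 0 (d * (w / 2 - 1)), ∃ K : EuclideanSpace ℝ (Fin d) → ℂ,
      Continuous K ∧ (∀ x, ‖K x‖ ≤ C) ∧
      (∀ J (x : EuclideanSpace ℝ (Fin d)), ‖invFourier (truncSymbol w η J) x‖ ≤ C) ∧
      ∀ x, Tendsto (fun J => invFourier (truncSymbol w η J) x) atTop (𝓝 (K x)) := by
  obtain ⟨C, hC, H⟩ := exists_dyadic_bound hd w hw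
  let V := 2 ^ ((d : ℝ) * (w / 2 - 1)) *
    (volume : Measure (EuclideanSpace ℝ (Fin d))).real (Metric.closedBall 0 2)
  -- `V` bounds the low frequencies, one `C` the geometric sum over noncritical scales, and `4 * C`
  -- the at most four critical ones.
  refine ⟨V + 5 * C, fun η hη => ?_⟩
  have hInt := integrable_truncSymbol (d := d) (w := w) (by linarith) hη.1
  let S : ℕ → EuclideanSpace ℝ (Fin d) → ℂ := fun J => invFourier (truncSymbol w η J)
  let D : ℕ → EuclideanSpace ℝ (Fin d) → ℂ := fun j x => S (j + 1) x - S j x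
  have hDeq : ∀ j x, D j x = invFourier
      (fun ξ => dispSymbol w η 1 ξ * (annulusCutoff (((2 : ℝ) ^ (j + 1))⁻¹ • ξ) : ℂ)) x := by
    intro j x
    simp only [D, S]
    rw [invFourier_sub (hInt _) (hInt _)]
    simp_rw [truncSymbol_succ_sub]
  have hD1 : ∀ j x, ‖D j x‖ ≤ C := fun j x => by
    rw [hDeq]; exact (H η hη _ (one_le_pow₀ one_le_two) x).1
  have hD2 : ∀ j x, Noncritical w (((2 : ℝ) ^ (j + 1)) ^ (1 - w) * ‖x‖) →
      ‖D j x‖ ≤ C * ((2 : ℝ) ^ (j + 1))⁻¹ := fun j x h => by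
    rw [hDeq]; exact (H η hη _ (one_le_pow₀ one_le_two) x).2 h
  have htel : ∀ J x, S J x = S 0 x + ∑ j ∈ Finset.range J, D j x := fun J x => by
    simp only [D]
    rw [Finset.sum_range_sub (fun j => S j x)]
    ring
  have hbound : ∀ J x, ‖S J x‖ ≤ V + 5 * C := by
    classical
    intro J x
    rw [htel]
    refine (norm_add_le _ _).trans (add_le_add (norm_invFourier_truncSymbol_zero_le hη x) ?_)
    have hj : ∀ j ∈ Finset.range J, ‖D j x‖ ≤ C * ((2 : ℝ) ^ (j + 1))⁻¹ +
        C * (if ¬ Noncritical w (((2 : ℝ) ^ (j + 1)) ^ (1 - w) * ‖x‖) then 1 else 0) := by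
      intro j _
      split_ifs with h
      · rw [mul_zero, add_zero]
        exact hD2 j x h
      · rw [mul_one]
        exact (hD1 j x).trans (le_add_of_nonneg_left (by positivity))
    refine (norm_sum_le_of_le _ hj).trans ?_
    rw [Finset.sum_add_distrib, ← Finset.mul_sum, ← Finset.mul_sum, Finset.sum_boole]
    have h1 := sum_half_pow_succ_le J
    have h2 : (((Finset.range J).filter fun j : ℕ =>
        ¬ Noncritical w (((2 : ℝ) ^ (j + 1)) ^ (1 - w) * ‖x‖)).card : ℝ) ≤ 4 := by
      exact_mod_cast card_critical_scales_le hw ‖x‖ (Finset.range J)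
    nlinarith [mul_le_mul_of_nonneg_left h1 hC, mul_le_mul_of_nonneg_left h2 hC]
  -- For `‖x‖ < r` every scale beyond some `2 ^ n` is noncritical, since `R^(1-w) ‖x‖ ≤ R⁻¹ r` is
  -- then below the lower threshold. The resulting summable majorant gives convergence and
  -- continuity.
  have hloc : ∀ r : ℝ, ∃ u : ℕ → ℝ, Summable u ∧ ∀ j, ∀ x ∈ Metric.ball 0 r, ‖D j x‖ ≤ u j := by
    intro r
    have hc : 0 < w * (1 / 2 : ℝ) ^ w := by
      have : 0 < w := by linarith
      positivity
    obtain ⟨n, hn⟩ := pow_unbounded_of_one_lt (r / (w * (1 / 2 : ℝ) ^ w)) one_lt_two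
    refine ⟨fun j => C * ((2 : ℝ) ^ (j + 1))⁻¹ + if j < n then C else 0, ?_, fun j x hx => ?_⟩
    · refine Summable.add ?_ ?_
      · have := (summable_nat_add_iff 1).2 (summable_geometric_of_lt_one
          (by norm_num : (0 : ℝ) ≤ 2⁻¹) (by norm_num))
        simpa only [inv_pow] using this.mul_left C
      · refine summable_of_ne_finset_zero (s := Finset.range n) fun j hj => ?_
        rw [if_neg (by simpa using hj)]
    · by_cases hj : j < n
      · simp only [if_pos hj]
        exact (hD1 j x).trans (le_add_of_nonneg_left (by positivity))
      · simp only [if_neg hj, add_zero]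
        refine hD2 j x (Or.inl ?_)
        have hx' : ‖x‖ < r := by simpa using hx
        have hp : ((2 : ℝ) ^ (j + 1)) ^ (1 - w) ≤ (2 ^ n)⁻¹ := by
          calc ((2 : ℝ) ^ (j + 1)) ^ (1 - w) ≤ ((2 : ℝ) ^ (j + 1)) ^ (-1 : ℝ) :=
                Real.rpow_le_rpow_of_exponent_le (one_le_pow₀ one_le_two) (by linarith)
            _ = (2 ^ (j + 1))⁻¹ := Real.rpow_neg_one _
            _ ≤ (2 ^ n)⁻¹ := by
                gcongr
                · exact one_le_two
                · omega
        rw [div_lt_iff₀ hc] at hn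
        calc ((2 : ℝ) ^ (j + 1)) ^ (1 - w) * ‖x‖ ≤ (2 ^ n)⁻¹ * (2 ^ n * (w * (1 / 2) ^ w)) := by
              gcongr; linarith
          _ = w * (1 / 2) ^ w := by field_simp
  have hsum : ∀ x, Summable fun j => D j x := fun x => by
    obtain ⟨u, hu, hb⟩ := hloc (‖x‖ + 1)
    exact Summable.of_norm_bounded hu fun j => hb j x (by simp)
  let K : EuclideanSpace ℝ (Fin d) → ℂ := fun x => S 0 x + ∑' j, D j x
  have htend : ∀ x, Tendsto (fun J => S J x) atTop (𝓝 (K x)) := fun x => by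
    exact ((hsum x).hasSum.tendsto_sum_nat.const_add (S 0 x)).congr fun J => (htel J x).symm
  have hScont : ∀ J, Continuous (S J) := fun J => continuous_invFourier (hInt J)
  refine ⟨K, ?_, fun x => ?_, hbound, htend⟩
  · refine (hScont 0).add ?_
    rw [continuous_iff_continuousAt]
    intro x
    obtain ⟨u, hu, hb⟩ := hloc (‖x‖ + 1)
    have : ContinuousOn (fun x => ∑' j, D j x) (Metric.ball 0 (‖x‖ + 1)) :=
      continuousOn_tsum (fun j => ((hScont (j + 1)).sub (hScont j)).continuousOn) hu hb
    exact this.continuousAt (Metric.isOpen_ball.mem_nhds (by simp))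
  · exact le_of_tendsto (htend x).norm (Eventually.of_forall fun J => hbound J x)

/-- `K` is the inverse Fourier transform of `m`, tested against all integrable functions for which
the pairing with `m` converges. -/
def IsWeakInvFourier (m K : EuclideanSpace ℝ (Fin d) → ℂ) : Prop :=
  ∀ φ : EuclideanSpace ℝ (Fin d) → ℂ, Integrable φ → Integrable (fun ξ => m ξ * invFourier φ ξ) →
    ∫ ξ, m ξ * invFourier φ ξ = ∫ x, K x * φ x

/-- Dominated convergence applies on both sides of the multiplication formula: truncation only
decreases the symbol, and the truncated kernels share the bound `C`. -/
theorem isWeakInvFourier_of_tendsto {w η C : ℝ} (hw : 0 ≤ w) (hη : 0 ≤ η)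
    {K : EuclideanSpace ℝ (Fin d) → ℂ}
    (hC : ∀ J (x : EuclideanSpace ℝ (Fin d)), ‖invFourier (truncSymbol w η J) x‖ ≤ C)
    (hK : ∀ x, Tendsto (fun J => invFourier (truncSymbol w η J) x) atTop (𝓝 (K x))) :
    IsWeakInvFourier (dispSymbol w η 1) K := by
  intro φ hφ hm
  have hInt := integrable_truncSymbol (d := d) (w := w) hw hη
  have h1 : Tendsto (fun J => ∫ ξ, truncSymbol w η J ξ * invFourier φ ξ) atTop
      (𝓝 (∫ ξ, dispSymbol w η 1 ξ * invFourier φ ξ)) := by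
    refine tendsto_integral_of_dominated_convergence
      (fun ξ => ‖dispSymbol w η 1 ξ * invFourier φ ξ‖) (fun J => ?_) hm.norm (fun J => ?_) ?_
    · exact (hInt J).aestronglyMeasurable.mul (continuous_invFourier hφ).aestronglyMeasurable
    · refine ae_of_all _ fun ξ => ?_
      rw [norm_mul, norm_mul]
      exact mul_le_mul_of_nonneg_right (norm_truncSymbol_le w η J ξ) (norm_nonneg _)
    · exact ae_of_all _ fun ξ => (tendsto_truncSymbol w η ξ).mul_const _
  have h2 : Tendsto (fun J => ∫ x, invFourier (truncSymbol w η J) x * φ x) atTop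
      (𝓝 (∫ x, K x * φ x)) := by
    refine tendsto_integral_of_dominated_convergence (fun x => C * ‖φ x‖) (fun J => ?_)
      (hφ.norm.const_mul C) (fun J => ?_) ?_
    · exact (continuous_invFourier (hInt J)).aestronglyMeasurable.mul hφ.aestronglyMeasurable
    · refine ae_of_all _ fun x => ?_
      rw [norm_mul]
      exact mul_le_mul_of_nonneg_right (hC J x) (norm_nonneg _)
    · exact ae_of_all _ fun x => (hK x).mul_const _
  simp_rw [integral_invFourier_mul (hInt _) hφ] at h1
  exact tendsto_nhds_unique h1 h2

end Kernel

/-! ### From the weak identity to oscillatory integrals, and scaling in time -/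

section Oscillatory

variable {d : ℕ}

/-- The inverse Fourier transform of a rescaled and translated function. -/
theorem invFourier_rescale (φ : EuclideanSpace ℝ (Fin d) → ℂ) {ε : ℝ} (hε : 0 < ε)
    (x ξ : EuclideanSpace ℝ (Fin d)) :
    invFourier (fun y => (((ε ^ d)⁻¹ : ℝ) : ℂ) * φ (ε⁻¹ • (y - x))) ξ =
      Complex.exp (Complex.I * ((inner ℝ x ξ : ℝ) : ℂ)) * invFourier φ (ε • ξ) := by
  let g : EuclideanSpace ℝ (Fin d) → ℂ := fun z =>
    Complex.exp (Complex.I * ((inner ℝ x ξ : ℝ) : ℂ)) * ((((ε ^ d)⁻¹ : ℝ) : ℂ) *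
      (Complex.exp (Complex.I * ((inner ℝ z (ε • ξ) : ℝ) : ℂ)) * φ z))
  have hpt : ∀ y, Complex.exp (Complex.I * ((inner ℝ y ξ : ℝ) : ℂ)) *
      ((((ε ^ d)⁻¹ : ℝ) : ℂ) * φ (ε⁻¹ • (y - x))) = g (ε⁻¹ • (y - x)) := by
    intro y
    have : (inner ℝ y ξ : ℝ) = inner ℝ x ξ + inner ℝ (ε⁻¹ • (y - x)) (ε • ξ) := by
      rw [real_inner_smul_left, real_inner_smul_right, inner_sub_left]
      field_simp
      ring
    simp only [g]
    rw [this, Complex.ofReal_add, mul_add, Complex.exp_add]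
    ring
  rw [invFourier]
  simp_rw [hpt]
  rw [integral_sub_right_eq_self (fun y => g (ε⁻¹ • y)) x,
    Measure.integral_comp_inv_smul volume g ε]
  simp only [g]
  rw [integral_const_mul, integral_const_mul, ← invFourier]
  simp only [finrank_euclideanSpace, Fintype.card_fin, Complex.real_smul]
  rw [abs_of_pos (by positivity)]
  have : ((ε ^ d : ℝ) : ℂ) ≠ 0 := by exact_mod_cast (by positivity : ε ^ d ≠ 0)
  rw [Complex.ofReal_inv]
  field_simp

theorem invFourier_eq_fourierInv (φ : EuclideanSpace ℝ (Fin d) → ℂ)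
    (ξ : EuclideanSpace ℝ (Fin d)) :
    invFourier φ ξ = FourierTransformInv.fourierInv φ ((2 * Real.pi)⁻¹ • ξ) := by
  rw [invFourier, Real.fourierInv_eq']
  congr 1 with x
  rw [smul_eq_mul, real_inner_smul_right]
  congr 2
  push_cast
  have : (Real.pi : ℂ) ≠ 0 := by exact_mod_cast Real.pi_ne_zero
  field_simp

/-- Every Schwartz function is the inverse Fourier transform of an integrable function. -/
theorem exists_invFourier_eq (χ : 𝓢(EuclideanSpace ℝ (Fin d), ℂ)) :
    ∃ φ : EuclideanSpace ℝ (Fin d) → ℂ, Integrable φ ∧ ∀ ξ, invFourier φ ξ = χ ξ := by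
  let ψ : 𝓢(EuclideanSpace ℝ (Fin d), ℂ) := FourierTransform.fourier χ
  have hπ : 0 < 2 * Real.pi := by positivity
  -- Mathlib's transform has phase `2π x·ξ`; dilation by `2π` restores `x·ξ`. The shift by 0 matches
  -- the form of `invFourier_rescale`.
  refine ⟨fun y => ((((2 * Real.pi) ^ d)⁻¹ : ℝ) : ℂ) * ψ ((2 * Real.pi)⁻¹ • (y - 0)), ?_, ?_⟩
  · simp_rw [sub_zero]
    exact (ψ.integrable.comp_smul (inv_pos.2 hπ).ne').const_mul _
  · intro ξ
    rw [invFourier_rescale ψ hπ 0 ξ, invFourier_eq_fourierInv, smul_smul,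
      inv_mul_cancel₀ hπ.ne', one_smul, ← SchwartzMap.fourierInv_coe]
    simp [ψ]

theorem integrable_dispSymbol_mul {w η : ℝ} (hw : 0 ≤ w) (hη : 0 ≤ η) (t : ℝ)
    (χ : 𝓢(EuclideanSpace ℝ (Fin d), ℂ)) {ε : ℝ} (hε : 0 < ε) :
    Integrable fun ξ => dispSymbol w η t ξ * χ (ε • ξ) := by
  obtain ⟨n, hn⟩ := exists_nat_ge η
  have h1 : Integrable fun ξ : EuclideanSpace ℝ (Fin d) => ‖χ ξ‖ + ‖ξ‖ ^ n * ‖χ ξ‖ :=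
    χ.integrable.norm.add (χ.integrable_pow_mul volume n)
  have h2 := (h1.comp_smul hε.ne').const_mul (ε⁻¹ ^ η)
  refine h2.mono' ?_ (ae_of_all _ fun ξ => ?_)
  · exact ((continuous_dispSymbol hw hη t).mul
      (χ.continuous.comp (continuous_const_smul _))).aestronglyMeasurable
  · rw [norm_mul, norm_dispSymbol]
    have h3 : ‖ξ‖ ^ η = ε⁻¹ ^ η * ‖ε • ξ‖ ^ η := by
      rw [← Real.mul_rpow (by positivity) (norm_nonneg _), norm_smul, Real.norm_of_nonneg hε.le,
        ← mul_assoc, inv_mul_cancel₀ hε.ne', one_mul]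
    have h4 : ‖ε • ξ‖ ^ η ≤ 1 + ‖ε • ξ‖ ^ n := by
      rcases le_total ‖ε • ξ‖ 1 with h | h
      · exact (Real.rpow_le_one (norm_nonneg _) h hη).trans (le_add_of_nonneg_right (by positivity))
      · rw [← Real.rpow_natCast]
        exact (Real.rpow_le_rpow_of_exponent_le h hn).trans (le_add_of_nonneg_left zero_le_one)
    rw [h3, mul_assoc]
    refine mul_le_mul_of_nonneg_left ?_ (by positivity)
    calc ‖ε • ξ‖ ^ η * ‖χ (ε • ξ)‖ ≤ (1 + ‖ε • ξ‖ ^ n) * ‖χ (ε • ξ)‖ := by gcongr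
      _ = _ := by ring

/-- A bounded continuous function which is weakly the inverse Fourier transform of the symbol
is the dispersive kernel. -/
theorem isDispersiveKernel_of_isWeakInvFourier {w η t C : ℝ} (hw : 0 ≤ w) (hη : 0 ≤ η)
    {K : EuclideanSpace ℝ (Fin d) → ℂ} (hK : Continuous K) (hC : ∀ x, ‖K x‖ ≤ C)
    (h : IsWeakInvFourier (dispSymbol w η t) K) : IsDispersiveKernel d w η t K := by
  refine ⟨fun x χ hχ => ?_, fun φ => ?_⟩
  · have hsplit : ∀ ξ : EuclideanSpace ℝ (Fin d),
        Complex.exp (Complex.I * ((t * ‖ξ‖ ^ w + inner ℝ x ξ : ℝ) : ℂ)) * ((‖ξ‖ ^ η : ℝ) : ℂ) =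
        Complex.exp (Complex.I * ((inner ℝ x ξ : ℝ) : ℂ)) * dispSymbol w η t ξ := by
      intro ξ
      rw [dispSymbol, Complex.ofReal_add, mul_add, Complex.exp_add]
      ring
    simp only [hsplit]
    have hInt : ∀ ε : ℝ, 0 < ε → Integrable fun ξ =>
        Complex.exp (Complex.I * ((inner ℝ x ξ : ℝ) : ℂ)) * dispSymbol w η t ξ * χ (ε • ξ) := by
      intro ε hε
      have := integrable_exp_I_inner_mul (integrable_dispSymbol_mul hw hη t χ hε) x
      refine this.congr (ae_of_all _ fun ξ => ?_)
      simp only [real_inner_comm x ξ]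
      ring
    refine ⟨hInt, ?_⟩
    obtain ⟨φ, hφ, hφχ⟩ := exists_invFourier_eq χ
    -- The modulated, dilated cutoff is the inverse transform of the translated, rescaled profile
    -- `φε`. The weak identity therefore turns the regularized integral into an average of `K` near
    -- `x`.
    have hval : ∀ ε : ℝ, 0 < ε → ∫ ξ,
        Complex.exp (Complex.I * ((inner ℝ x ξ : ℝ) : ℂ)) * dispSymbol w η t ξ * χ (ε • ξ) =
        ∫ z, K (x + ε • z) * φ z := by
      intro ε hε
      let φε : EuclideanSpace ℝ (Fin d) → ℂ := fun y =>
        (((ε ^ d)⁻¹ : ℝ) : ℂ) * φ (ε⁻¹ • (y - x))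
      have hφε : Integrable φε := by
        have h1 := hφ.comp_smul (inv_pos.2 hε).ne'
        exact (h1.comp_sub_right x).const_mul _
      have heq : ∀ ξ, Complex.exp (Complex.I * ((inner ℝ x ξ : ℝ) : ℂ)) * dispSymbol w η t ξ *
          χ (ε • ξ) = dispSymbol w η t ξ * invFourier φε ξ := by
        intro ξ
        simp only [φε]
        rw [invFourier_rescale φ hε x ξ, hφχ]
        ring
      have hi := hInt ε hε
      simp_rw [heq] at hi ⊢
      rw [h φε hφε hi]
      let G : EuclideanSpace ℝ (Fin d) → ℂ := fun z => (((ε ^ d)⁻¹ : ℝ) : ℂ) *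
        (K (x + ε • z) * φ z)
      have hG : ∀ y, K y * φε y = G (ε⁻¹ • (y - x)) := by
        intro y
        simp only [G, φε]
        rw [smul_smul, mul_inv_cancel₀ hε.ne', one_smul, add_sub_cancel]
        ring
      simp_rw [hG]
      rw [integral_sub_right_eq_self (fun y => G (ε⁻¹ • y)) x,
        Measure.integral_comp_inv_smul volume G ε]
      simp only [G]
      rw [integral_const_mul]
      simp only [finrank_euclideanSpace, Fintype.card_fin, Complex.real_smul]
      rw [abs_of_pos (by positivity), ← mul_assoc, ← Complex.ofReal_mul,
        mul_inv_cancel₀ (by positivity), Complex.ofReal_one, one_mul]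
    -- The normalization `χ 0 = 1` says that `φ` has mass one.
    have hmass : ∫ z, φ z = 1 := by
      have := hφχ 0
      rw [hχ, invFourier] at this
      simpa using this
    have hlim : Tendsto (fun ε : ℝ => ∫ z, K (x + ε • z) * φ z) (𝓝[>] 0)
        (𝓝 (∫ z, K x * φ z)) := by
      refine tendsto_integral_filter_of_dominated_convergence (fun z => C * ‖φ z‖)
        (Eventually.of_forall fun ε => ?_) (Eventually.of_forall fun ε => ?_)
        (hφ.norm.const_mul C) (ae_of_all _ fun z => ?_)
      · exact (hK.comp (by fun_prop)).aestronglyMeasurable.mul hφ.aestronglyMeasurable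
      · refine ae_of_all _ fun z => ?_
        rw [norm_mul]
        exact mul_le_mul_of_nonneg_right (hC _) (norm_nonneg _)
      · have h1 : Continuous fun ε : ℝ => K (x + ε • z) * φ z :=
          (hK.comp (by fun_prop)).mul continuous_const
        have h2 := h1.tendsto 0
        simp only [zero_smul, add_zero] at h2
        exact h2.mono_left nhdsWithin_le_nhds
    rw [integral_const_mul, hmass, mul_one] at hlim
    refine hlim.congr' ?_
    filter_upwards [self_mem_nhdsWithin] with ε hε using (hval ε hε).symm
  · have hφ : Integrable (φ : EuclideanSpace ℝ (Fin d) → ℂ) := φ.integrable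
    have hm : Integrable fun ξ => dispSymbol w η t ξ * invFourier φ ξ := by
      have := integrable_dispSymbol_mul hw hη t (FourierTransformInv.fourierInv φ)
        (inv_pos.2 (by positivity : 0 < 2 * Real.pi))
      refine this.congr (ae_of_all _ fun ξ => ?_)
      simp only []
      rw [invFourier_eq_fourierInv, ← SchwartzMap.fourierInv_coe]
    exact ⟨hm, hφ.bdd_mul hK.aestronglyMeasurable (ae_of_all _ hC), h φ hφ hm⟩

/-- Rescaling in time. -/
theorem IsWeakInvFourier.rescale {w η t : ℝ} (hw : 0 < w) (ht : 0 < t)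
    {K : EuclideanSpace ℝ (Fin d) → ℂ} (h : IsWeakInvFourier (dispSymbol w η 1) K) :
    IsWeakInvFourier (dispSymbol w η t) fun x =>
      ((t ^ (-((d : ℝ) + η) / w) : ℝ) : ℂ) * K (t ^ (-1 / w) • x) := by
  intro φ hφ hm
  -- This scale gives `t ‖s ζ‖^w = ‖ζ‖^w`. In the prefactor, `s ^ d` is the Jacobian and `s ^ η`
  -- comes from the amplitude.
  set s := t ^ (-1 / w) with hs
  have hs0 : 0 < s := by positivity
  have hsw : s ^ w * t = 1 := by
    rw [hs, ← Real.rpow_mul ht.le, div_mul_cancel₀ _ hw.ne', Real.rpow_neg_one,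
      inv_mul_cancel₀ ht.ne']
  have hsd : t ^ (-((d : ℝ) + η) / w) = s ^ d * s ^ η := by
    rw [← Real.rpow_natCast, ← Real.rpow_add hs0, hs, ← Real.rpow_mul ht.le]
    congr 1
    ring
  let φs : EuclideanSpace ℝ (Fin d) → ℂ := fun y => (((s ^ d)⁻¹ : ℝ) : ℂ) * φ (s⁻¹ • (y - 0))
  have hφs : Integrable φs := by
    simp only [φs, sub_zero]
    exact (hφ.comp_smul (inv_pos.2 hs0).ne').const_mul _
  have hsym : ∀ ζ : EuclideanSpace ℝ (Fin d),
      dispSymbol w η t (s • ζ) = ((s ^ η : ℝ) : ℂ) * dispSymbol w η 1 ζ := by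
    intro ζ
    have hn : ‖s • ζ‖ = s * ‖ζ‖ := by rw [norm_smul, Real.norm_of_nonneg hs0.le]
    rw [dispSymbol, dispSymbol, hn, Real.mul_rpow hs0.le (norm_nonneg _),
      Real.mul_rpow hs0.le (norm_nonneg _), ← mul_assoc t, mul_comm t, hsw]
    push_cast
    ring
  have hinv : ∀ ζ, invFourier φs ζ = invFourier φ (s • ζ) := by
    intro ζ
    simp only [φs]
    rw [invFourier_rescale φ hs0 0 ζ]
    simp
  have hsη : ((s ^ η : ℝ) : ℂ) ≠ 0 := by exact_mod_cast (by positivity : s ^ η ≠ 0)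
  have hsd0 : ((s ^ d : ℝ) : ℂ) ≠ 0 := by exact_mod_cast (by positivity : s ^ d ≠ 0)
  have hpt : ∀ ζ, dispSymbol w η t (s • ζ) * invFourier φ (s • ζ) =
      ((s ^ η : ℝ) : ℂ) * (dispSymbol w η 1 ζ * invFourier φs ζ) := by
    intro ζ
    rw [hsym, hinv, mul_assoc]
  have hm1 : Integrable fun ζ => dispSymbol w η 1 ζ * invFourier φs ζ := by
    have h1 := (hm.comp_smul hs0.ne').const_mul (((s ^ η : ℝ) : ℂ)⁻¹)
    simp_rw [hpt] at h1
    refine h1.congr (ae_of_all _ fun ζ => ?_)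
    simp only []
    rw [inv_mul_cancel_left₀ hsη]
  have hL : ((s ^ d : ℝ) : ℂ) * ∫ ζ, dispSymbol w η t (s • ζ) * invFourier φ (s • ζ) =
      ∫ ξ, dispSymbol w η t ξ * invFourier φ ξ := by
    rw [Measure.integral_comp_smul_of_nonneg volume
      (fun ξ => dispSymbol w η t ξ * invFourier φ ξ) s (hR := hs0.le)]
    simp only [finrank_euclideanSpace, Fintype.card_fin, Complex.real_smul]
    rw [Complex.ofReal_inv, mul_inv_cancel_left₀ hsd0]
  have hR : ∫ y, K y * φs y = ∫ x, K (s • x) * φ x := by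
    let G : EuclideanSpace ℝ (Fin d) → ℂ := fun x => (((s ^ d)⁻¹ : ℝ) : ℂ) * (K (s • x) * φ x)
    have hG : ∀ y, K y * φs y = G (s⁻¹ • y) := by
      intro y
      simp only [G, φs]
      rw [smul_smul, mul_inv_cancel₀ hs0.ne', one_smul, sub_zero]
      ring
    simp_rw [hG]
    rw [Measure.integral_comp_inv_smul volume G s]
    simp only [G]
    rw [integral_const_mul]
    simp only [finrank_euclideanSpace, Fintype.card_fin, Complex.real_smul]
    rw [abs_of_pos (by positivity), Complex.ofReal_inv, mul_inv_cancel_left₀ hsd0]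
  rw [← hL]
  simp_rw [hpt]
  rw [integral_const_mul, h φs hφs hm1, hR, hsd]
  simp_rw [mul_assoc]
  rw [integral_const_mul]
  push_cast
  ring

end Oscillatory

/-! ### Conclusion -/

theorem lemma3p6 (d : ℕ) (hd : 1 ≤ d) (ϖ : ℝ) (hϖ : 2 ≤ ϖ) :
    ∃ C : ℝ, ∀ η : ℝ, 0 ≤ η / (d : ℝ) → η / (d : ℝ) ≤ ϖ / 2 - 1 →
      ∃ K : EuclideanSpace ℝ (Fin d) → ℂ,
        IsDispersiveKernel d ϖ η 1 K ∧ (∀ x, ‖K x‖ ≤ C) ∧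
        ∀ t : ℝ, 0 < t →
          ∃ Kt : EuclideanSpace ℝ (Fin d) → ℂ,
            IsDispersiveKernel d ϖ η t Kt ∧
            (∀ x, Kt x = ((t ^ (-((d : ℝ) + η) / ϖ) : ℝ) : ℂ) * K (t ^ (-1 / ϖ) • x)) ∧
            ∀ x, ‖Kt x‖ ≤ C * t ^ (-((d : ℝ) + η) / ϖ) := by
  obtain ⟨C, H⟩ := exists_kernel hd ϖ hϖ
  refine ⟨C, fun η h0 h1 => ?_⟩
  have hd0 : (0 : ℝ) < d := by exact_mod_cast hd
  have hw0 : 0 < ϖ := by linarith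
  have hη : 0 ≤ η := by simpa [div_mul_cancel₀ _ hd0.ne'] using mul_nonneg h0 hd0.le
  have hη' : η ≤ d * (ϖ / 2 - 1) := by rwa [div_le_iff₀ hd0, mul_comm] at h1
  obtain ⟨K, hKc, hKC, hTC, hT⟩ := H η ⟨hη, hη'⟩
  have hweak := isWeakInvFourier_of_tendsto hw0.le hη hTC hT
  refine ⟨K, isDispersiveKernel_of_isWeakInvFourier hw0.le hη hKc hKC hweak, hKC,
    fun t ht => ?_⟩
  have hbound : ∀ x : EuclideanSpace ℝ (Fin d),
      ‖((t ^ (-((d : ℝ) + η) / ϖ) : ℝ) : ℂ) * K (t ^ (-1 / ϖ) • x)‖ ≤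
        C * t ^ (-((d : ℝ) + η) / ϖ) := by
    intro x
    rw [norm_mul, Complex.norm_real, Real.norm_of_nonneg (by positivity), mul_comm]
    exact mul_le_mul_of_nonneg_right (hKC _) (by positivity)
  -- The kernel at time `t` is defined by the scaling formula, and the rescaled weak identity
  -- certifies it.
  refine ⟨_, isDispersiveKernel_of_isWeakInvFourier hw0.le hη ?_ hbound (hweak.rescale hw0 ht),
    fun x => rfl, hbound⟩
  exact continuous_const.mul (hKc.comp (continuous_const_smul _))
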